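/- Let $K$ be a field of characteristic $0$, let $s,t\in K$, and put $\alpha=s+t$, $\beta=st$. Let $$f(x)=\frac{e^{sx}-e^{tx}}{se^{tx}-te^{sx}}\in K[[x]]$$ (numerator and denominator being first divided by $s-t$, so that $f(x)=x/(1-sx)$ for $s=t$). **The coefficients $c_{IJ}$.** In the free associative $K$-algebra on $S_1,S_2,\dots$ (noncommutative symmetric functions), with $S_0=1$, let $\varphi=\log\sum_{n\ge0}S_n$ and let $Y_n$ be the component of degree $n$ of $f(\varphi)$. For a composition $I=(i_1,\dots,i_r)$ put $S^I=S_{i_1}\cdots S_{i_r}$ and $Y^I=Y_{i_1}\cdots Y_{i_r}$. Then $(Y^I)$ is a basis of this algebra; let $(X_I)$ be the dual basis of quasi-symmetric functions and write $X_I=\sum_J c_{IJ}M_J$, where $(M_J)$ is dual to $(S^J)$; equivalently $S^J=\sum_I c_{IJ}Y^I$. **WQSym.** A word over the positive integers is packed if its letters are exactly $1,\dots,m$ for some $m\ge0$; $\mathrm{pack}(w)$ replaces each letter of $w$ by its rank among the letters of $w$; $\mathrm{ev}(u)$ is the composition of the numbers of occurrences of $1,\dots,\max(u)$ in $u$. $\mathbf{WQSym}$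 has a basis $\mathbf M_u$ indexed by packed words, with $$\mathbf M_u\mathbf M_v=\sum_{w=u'v',\ \mathrm{pack}(u')=u,\ \mathrm{pack}(v')=v}\mathbf M_w\qquad(w\text{ packed}).$$ Write $v\le u$ if $v$ is obtained from $u$ by applying a weakly increasing map to its letters (merging consecutive letters), and set $$\mathbf X_u=\sum_{v\le u}c_{\mathrm{ev}(u)\,\mathrm{ev}(v)}\,\mathbf M_v .$$ **The $(\alpha,\beta)$-quasi-shuffle.** For words over an additive semigroup it is given by $w\star\epsilon=\epsilon\star w=w$ and $$au\star bv=a(u\star bv)+b(au\star v)+\alpha\,[a+b]\cdot(u\star v)+\beta\,\zeta_{a+b}(u\star v),$$ where $\zeta_x(aw)=[x+a]\,w$ and $\zeta_x(\epsilon)=0$. A packed word $u$ is encoded by the $0$-$1$ matrix whose entry $(i,j)$ is $1$ iff $u_j=i$, and a matrix is regarded as the word of its rows, completed by zeros on the right. The shifted $(\alpha,\beta)$-quasi-shuffle of the matrices of $u$ and $v$ is the quasi-shuffle of the matrix of $u$ with that of $v$ preceded by $|u|$ zero columns. **Theorem.** $(\mathbf X_u)$, for $u$ in the set of packed words, is a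 basis of $\mathbf{WQSym}$. For packed words $u,v$, only matrices of packed words $w$ of length $|u|+|v|$ occur in the shifted $(\alpha,\beta)$-quasi-shuffle of the matrices of $u$ and $v$. If $f_{uv}^w$ denotes the coefficient of the matrix of $w$ in it, then $$\mathbf X_u\mathbf X_v=\sum_w f_{uv}^w\,\mathbf X_w .$$ The product is multiplicity-free: as a polynomial in $\alpha,\beta$ each coefficient of the shifted quasi-shuffle is $0$ or a single monomial $\alpha^i\beta^j$ with coefficient $1$. Explicitly, if there are $j,k$ such that $u_j\le u_k$ and $w_j>w_k$, or such that $v_j\le v_k$ and $w_{j+|u|}>w_{k+|u|}$, then $f_{uv}^w=0$. Otherwise, let $a_i$ be the number of different values $u_j$ such that $w_j=i$, and $b_i$ the number of different values $v_j$ such that $w_{j+|u|}=i$; then $$f_{uv}^w=\prod_{i=1}^{\max(w)}f_{uv}^w(i),\qquad f_{uv}^w(i)=\begin{cases}0&\text{if }|a_i-b_i|>1,\\ \alpha\beta^{a_i-1}&\text{if }a_i=b_i,\\ \beta^{\min(a_i,b_i)}&\text{otherwise.}\end{cases}$$ -/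

import Mathlib

open Finset

noncomputable section

namespace WQS

/-! ### The series `f` with formal group law `(x + y + α x y) / (1 - β x y)` -/

/-- The divided difference `(e^{s x} - e^{t x}) / (s - t)`: the coefficient of `x ^ n` is
`(s ^ (n-1) + s ^ (n-2) t + ⋯ + t ^ (n-1)) / n!`. -/
def fNum {K : Type*} [Field K] (s t : K) : PowerSeries K :=
  PowerSeries.mk fun n => (∑ i ∈ range n, s ^ i * t ^ (n - 1 - i)) / (n.factorial : K)

/-- The divided difference `(s e^{t x} - t e^{s x}) / (s - t) = e^{t x} - t fNum`; its constant
term is `1`. -/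
def fDen {K : Type*} [Field K] (s t : K) : PowerSeries K :=
  (PowerSeries.mk fun n => t ^ n / (n.factorial : K)) - PowerSeries.C t * fNum s t

/-- The series `f(x) = (e^{s x} - e^{t x}) / (s e^{t x} - t e^{s x})`, numerator and denominator
being divided by `s - t`, so that it also makes sense for `s = t`. -/
def fSeries {K : Type*} [Field K] (s t : K) : PowerSeries K :=
  fNum s t * (fDen s t)⁻¹

theorem C_mul_fNum {K : Type*} [Field K] [CharZero K] (s t : K) :
    PowerSeries.C (s - t) * fNum s t =
      PowerSeries.rescale s (PowerSeries.exp K) - PowerSeries.rescale t (PowerSeries.exp K) := by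
  ext n
  have h := Commute.mul_geom_sum₂ (Commute.all s t) n
  rw [fNum, PowerSeries.coeff_C_mul, PowerSeries.coeff_mk, ← mul_div_assoc, h]
  simp only [map_sub, PowerSeries.coeff_rescale, PowerSeries.coeff_exp, map_div₀, map_one,
    map_natCast]
  ring

theorem C_mul_fDen {K : Type*} [Field K] [CharZero K] (s t : K) :
    PowerSeries.C (s - t) * fDen s t =
      PowerSeries.C s * PowerSeries.rescale t (PowerSeries.exp K) -
        PowerSeries.C t * PowerSeries.rescale s (PowerSeries.exp K) := by
  have h := C_mul_fNum s t
  have e : (PowerSeries.mk fun n => t ^ n / (n.factorial : K)) =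
      PowerSeries.rescale t (PowerSeries.exp K) := by
    ext n
    simp [PowerSeries.coeff_rescale, PowerSeries.coeff_exp, div_eq_mul_inv]
  rw [fDen, e, mul_sub, mul_left_comm, h, map_sub]
  ring

/-- The defining identity of `f`, without division. -/
theorem fSeries_mul {K : Type*} [Field K] [CharZero K] (s t : K) :
    fSeries s t * (PowerSeries.C s * PowerSeries.rescale t (PowerSeries.exp K) -
        PowerSeries.C t * PowerSeries.rescale s (PowerSeries.exp K)) =
      PowerSeries.rescale s (PowerSeries.exp K) - PowerSeries.rescale t (PowerSeries.exp K) := by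
  have h0 : PowerSeries.constantCoeff (fDen s t) ≠ 0 := by
    rw [fDen, map_sub, map_mul, ← PowerSeries.coeff_zero_eq_constantCoeff_apply,
      ← PowerSeries.coeff_zero_eq_constantCoeff_apply (φ := fNum s t)]
    simp [fNum]
  rw [← C_mul_fDen, ← C_mul_fNum, fSeries]
  calc fNum s t * (fDen s t)⁻¹ * (PowerSeries.C (s - t) * fDen s t)
      = PowerSeries.C (s - t) * fNum s t * ((fDen s t)⁻¹ * fDen s t) := by ring
    _ = _ := by rw [PowerSeries.inv_mul_cancel _ h0, mul_one]

/-! ### Noncommutative symmetric functions and the coefficients `c_{IJ}` -/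

/-- Noncommutative symmetric functions: the free associative algebra on `S_1, S_2, …`. -/
abbrev NCSF (K : Type*) [Field K] : Type _ := FreeAlgebra K ℕ+

/-- The complete function `S_n`, with `S_0 = 1`. -/
def S (K : Type*) [Field K] (n : ℕ) : NCSF K :=
  if h : 0 < n then FreeAlgebra.ι K ⟨n, h⟩ else 1

/-- Substitution `p(g) = ∑ k, p_k g ^ k` of a series `g` without constant term, with coefficients
in a noncommutative algebra, in a scalar series `p` (the terms with `k > n` do not contribute to
the degree `n`). -/
def substNC {K A : Type*} [Field K] [Ring A] [Algebra K A] (p : PowerSeries K)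
    (g : PowerSeries A) : PowerSeries A :=
  PowerSeries.mk fun n =>
    ∑ k ∈ range (n + 1), PowerSeries.coeff k p • PowerSeries.coeff n (g ^ k)

/-- The series `log (1 + z)`. -/
def logSeries (K : Type*) [Field K] : PowerSeries K :=
  PowerSeries.mk fun k => if k = 0 then 0 else (-1) ^ (k - 1) / (k : K)

/-- `∑ n, φ_n x ^ n = log (∑ n, S_n x ^ n)`. -/
def phiSeries (K : Type*) [Field K] : PowerSeries (NCSF K) :=
  substNC (logSeries K) ((PowerSeries.mk fun n => S K n) - 1)

/-- `Y_n`, the component of degree `n` of `f(φ)`. -/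
def Y {K : Type*} [Field K] (s t : K) (n : ℕ) : NCSF K :=
  PowerSeries.coeff n (substNC (fSeries s t) (phiSeries K))

/-- `S ^ I = S_{i_1} ⋯ S_{i_r}`. -/
def SComp (K : Type*) [Field K] {n : ℕ} (I : Composition n) : NCSF K :=
  (I.blocks.map (S K)).prod

/-- `Y ^ I = Y_{i_1} ⋯ Y_{i_r}`. -/
def YComp {K : Type*} [Field K] (s t : K) {n : ℕ} (I : Composition n) : NCSF K :=
  (I.blocks.map (Y s t)).prod

/-- The matrix of `Y` on `S`: the entry `(I, J)` is the coefficient of `S ^ J` in `Y ^ I`. -/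
def yMatrix {K : Type*} [Field K] (s t : K) (n : ℕ) :
    Matrix (Composition n) (Composition n) K :=
  fun I J => (FreeAlgebra.basisFreeMonoid K ℕ+).repr (YComp s t I)
    (FreeMonoid.ofList (J.blocks.map Nat.toPNat'))

/-- The coefficients in `X_I = ∑ J, c_{IJ} M_J`, where `(X_I)` is the basis of quasi-symmetric
functions dual to `(Y ^ I)` and `(M_J)` is the one dual to `(S ^ J)`: the transpose of the
inverse of `yMatrix`. -/
def c {K : Type*} [Field K] (s t : K) {n : ℕ} (I J : Composition n) : K :=
  (yMatrix s t n)⁻¹ J I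

/-! ### Packed words and `WQSym` -/

/-- `u = u_1 ⋯ u_n` is packed if its letters are exactly `1, …, m` for some `m`. -/
def IsPacked {n : ℕ} (u : Fin n → ℕ) : Prop :=
  ∀ j, 1 ≤ u j ∧ ∀ i, 1 ≤ i → i ≤ u j → ∃ k, u k = i

/-- Packed words of length `n`. -/
abbrev PackedWord (n : ℕ) : Type := {u : Fin n → ℕ // IsPacked u}

/-- The greatest letter, `0` for the empty word. -/
def maxLetter {n : ℕ} (u : Fin n → ℕ) : ℕ := univ.sup u

theorem exists_eq_of_le_maxLetter {n : ℕ} {u : Fin n → ℕ} (hu : IsPacked u) {i : ℕ}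
    (h1 : 1 ≤ i) (h2 : i ≤ maxLetter u) : ∃ k, u k = i := by
  rcases (univ : Finset (Fin n)).eq_empty_or_nonempty with h | h
  · simp only [maxLetter, h, sup_empty, bot_eq_zero'] at h2
    omega
  · obtain ⟨j, -, hj⟩ := exists_mem_eq_sup univ h u
    exact (hu j).2 i h1 (by rw [← hj]; exact h2)

theorem letter_le_length {n : ℕ} {u : Fin n → ℕ} (hu : IsPacked u) (j : Fin n) : u j ≤ n := by
  have h : Icc 1 (u j) ⊆ univ.image u := by
    intro i hi
    obtain ⟨h1, h2⟩ := mem_Icc.1 hi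
    obtain ⟨k, hk⟩ := (hu j).2 i h1 h2
    exact mem_image.2 ⟨k, mem_univ _, hk⟩
  simpa using (card_le_card h).trans card_image_le

instance (n : ℕ) : Finite (PackedWord n) :=
  Finite.of_injective
    (fun u : PackedWord n => fun j => (⟨u.1 j, Nat.lt_succ_of_le (letter_le_length u.2 j)⟩ :
      Fin (n + 1)))
    (fun u v h => Subtype.ext (funext fun j => congrArg Fin.val (congrFun h j)))

instance (n : ℕ) : Fintype (PackedWord n) := Fintype.ofFinite _

/-- The packed word with the same relative order of letters: each letter is replaced by its rank
among the letters that occur. -/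
def pack {n : ℕ} (w : Fin n → ℕ) : Fin n → ℕ :=
  fun j => #{a ∈ univ.image w | a ≤ w j}

/-- The evaluation of a packed word: the numbers of occurrences of `1, …, max u`. -/
def ev {n : ℕ} (u : PackedWord n) : Composition n where
  blocks := (List.range (maxLetter u.1)).map fun i => #{j | u.1 j = i + 1}
  blocks_pos := by
    intro b hb
    obtain ⟨i, hi, rfl⟩ := List.mem_map.1 hb
    obtain ⟨k, hk⟩ := exists_eq_of_le_maxLetter u.2 (Nat.le_add_left 1 i)
      (List.mem_range.1 hi)
    exact card_pos.2 ⟨k, by simpa using hk⟩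
  blocks_sum := by
    have h : ∑ i ∈ range (maxLetter u.1), #{j | u.1 j = i + 1} = n := by
      have := card_eq_sum_card_fiberwise (s := (univ : Finset (Fin n)))
        (f := fun j => u.1 j - 1) (t := range (maxLetter u.1)) (by
          intro j _
          have h1 := (u.2 j).1
          have h2 : u.1 j ≤ maxLetter u.1 := le_sup (mem_univ j)
          simp only [coe_range, Set.mem_Iio]
          omega)
      rw [card_univ, Fintype.card_fin] at this
      refine (sum_congr rfl fun i _ => ?_).trans this.symm
      congr 1
      ext j
      have h1 := (u.2 j).1
      simp only [mem_filter, mem_univ, true_and]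
      omega
    simpa [Finset.sum_range, List.sum_ofFn, ← List.ofFn_eq_map, List.map_ofFn,
      Finset.sum, Multiset.range] using h

/-- `v ≤ u` in the (reverse) refinement order: `v` is obtained from `u` by a weakly increasing
map on letters, that is, by merging consecutive letters. -/
def Coarser {n : ℕ} (v u : PackedWord n) : Prop :=
  ∀ j k, u.1 j ≤ u.1 k → v.1 j ≤ v.1 k

/-- `WQSym`, on its monomial basis indexed by all packed words. -/
abbrev WQSym (K : Type*) [Field K] : Type _ := (Σ n, PackedWord n) →₀ K

/-- The monomial basis element `𝐌_u`. -/
def M (K : Type*) [Field K] {n : ℕ} (u : PackedWord n) : WQSym K := Finsupp.single ⟨n, u⟩ 1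

open Classical in
/-- `𝐌_u 𝐌_v = ∑ 𝐌_w`, over the packed words `w = u' v'` with `pack u' = u`, `pack v' = v`. -/
def mulM (K : Type*) [Field K] {m n : ℕ} (u : PackedWord m) (v : PackedWord n) : WQSym K :=
  ∑ w : PackedWord (m + n) with
    pack (fun j => w.1 (Fin.castAdd n j)) = u.1 ∧ pack (fun j => w.1 (Fin.natAdd m j)) = v.1,
    M K w

/-- The product of `WQSym`: the bilinear extension of `mulM`. -/
def mul {K : Type*} [Field K] (F G : WQSym K) : WQSym K :=
  Finsupp.sum F fun u a => Finsupp.sum G fun v b => (a * b) • mulM K u.2 v.2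

open Classical in
/-- `𝐗_u = ∑_{v ≤ u} c_{ev(u) ev(v)} 𝐌_v`. -/
def X {K : Type*} [Field K] (s t : K) {n : ℕ} (u : PackedWord n) : WQSym K :=
  ∑ v : PackedWord n with Coarser v u, c s t (ev u) (ev v) • M K v

/-! ### The `(α, β)`-quasi-shuffle -/

/-- `w ↦ a · w`, extended linearly. -/
def cons {R A : Type*} [CommSemiring R] (a : A) (F : List A →₀ R) : List A →₀ R :=
  F.mapDomain (List.cons a)

/-- `ζ_x (a w) = (x + a) w` and `ζ_x (ε) = 0`, extended linearly. -/
def zeta {R A : Type*} [CommSemiring R] [Add A] (x : A) (F : List A →₀ R) : List A →₀ R :=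
  F.sum fun w r => match w with
    | [] => 0
    | a :: w' => Finsupp.single ((x + a) :: w') r

/-- The `(α, β)`-quasi-shuffle of words over an additive semigroup:
`w ⋆ ε = ε ⋆ w = w` and
`a u ⋆ b v = a (u ⋆ b v) + b (a u ⋆ v) + α (a + b) (u ⋆ v) + β ζ_{a + b} (u ⋆ v)`. -/
def quasiShuffle {R A : Type*} [CommSemiring R] [Add A] (α β : R) :
    List A → List A → (List A →₀ R)
  | [], v => Finsupp.single v 1
  | a :: u, [] => Finsupp.single (a :: u) 1
  | a :: u, b :: v =>
      cons a (quasiShuffle α β u (b :: v)) + cons b (quasiShuffle α β (a :: u) v) +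
        α • cons (a + b) (quasiShuffle α β u v) + β • zeta (a + b) (quasiShuffle α β u v)
  termination_by u v => u.length + v.length

/-- Rows of matrices with nonnegative integer entries, completed by zeros on the right. -/
abbrev Row : Type := ℕ →₀ ℕ

/-- The `0`-`1` matrix of a packed word, as the list of its rows `i = 1, …, max u`; its entry
`(i, j)` is `1` iff the `j`-th letter is `i` (columns are numbered from `0` on). -/
def toMatrix {n : ℕ} (u : PackedWord n) : List Row :=
  (List.range (maxLetter u.1)).map fun i =>
    ∑ j : Fin n, if u.1 j = i + 1 then Finsupp.single (j : ℕ) 1 else 0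

/-- Insertion of `p` zero columns on the left of a matrix. -/
def shift (p : ℕ) (P : List Row) : List Row :=
  P.map (Finsupp.mapDomain fun j => p + j)

/-- The shifted `(α, β)`-quasi-shuffle of the matrices of two packed words. -/
def shiftedQuasiShuffle {R : Type*} [CommSemiring R] (α β : R) {m n : ℕ} (u : PackedWord m)
    (v : PackedWord n) : List Row →₀ R :=
  quasiShuffle α β (toMatrix u) (shift m (toMatrix v))

/-! ### The explicit coefficients -/

/-- The contribution of a letter `i` of `w`, where `a = a_i` and `b = b_i`. -/
def factor {R : Type*} [CommSemiring R] (α β : R) (a b : ℕ) : R :=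
  if a = b then α * β ^ (a - 1)
  else if a = b + 1 ∨ b = a + 1 then β ^ min a b
  else 0

/-- The number of different values `u_j` such that `w_j = i`. -/
def numValues {n : ℕ} (u w : Fin n → ℕ) (i : ℕ) : ℕ :=
  #(({j | w j = i} : Finset (Fin n)).image u)

open Classical in
/-- The coefficient `f_{uv}^w`. -/
def f {R : Type*} [CommSemiring R] (α β : R) {m n : ℕ} (u : PackedWord m) (v : PackedWord n)
    (w : PackedWord (m + n)) : R :=
  if (∃ j k, u.1 j ≤ u.1 k ∧ w.1 (Fin.castAdd n k) < w.1 (Fin.castAdd n j)) ∨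
      (∃ j k, v.1 j ≤ v.1 k ∧ w.1 (Fin.natAdd m k) < w.1 (Fin.natAdd m j)) then 0
  else ∏ i ∈ Icc 1 (maxLetter w.1),
    factor α β (numValues u.1 (fun j => w.1 (Fin.castAdd n j)) i)
      (numValues v.1 (fun j => w.1 (Fin.natAdd m j)) i)

end WQS

end

/-! Put `α = s + t`, `β = s t`. The series `f` satisfies `f' = 1 + α f + β f ^ 2`, the equation
attached to the formal group law `F(x, y) = (x + y + α x y) / (1 - β x y)`. Let `H = ∑ h_k y ^ k`
(`expCoeff`) be the series with `H(f(x)) = e ^ x`; it turns `F` into multiplication: `H(F(x, y)) =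
H(x) H(y)` (`coeff_partialExp`). Since `Y = f(log S)`, one has `S = H(Y)`, and expanding products of
the `S_n` shows that `c_{IJ}` is the product of the `h_k` over the lengths `k` of the blocks into
which `J` groups `I`, or `0` if `I` does not refine `J` (`contract`, `c_eq_contract`).

The coefficient of `x ^ a y ^ b` in `F` is also the weight with which the quasi-shuffle merges a
block of `a` letters of one word with a block of `b` letters of the other (`quasiShuffle_eq`). Hence
`P ↦ h_{|P|}` is a character of the quasi-shuffle (`shuffleEval_expCoeff`). Deconcatenation is
compatible with the quasi-shuffle (`shuffleEval_splitSum`), so contraction along a fixed word, a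
convolution of restrictions of this character, factors too (`shuffleEval_contract`). For the matrix
of `w`, this identity compares the coefficients of `𝐌_w` on the two sides of the product rule; zero
rows are harmless because `h_0 = 1`.

For matrices of packed words at most one decomposition into blocks is compatible with a given `w`
(`contractPair_range'`), so each coefficient is a single product of weights: this gives the explicit
formula and multiplicity-freeness. The basis statements follow from spanning, by comparing
dimensions in bounded degree. -/

noncomputable section

namespace WQS

/-! ### Sums over the deconcatenations of a list -/

/-- The sum of `g U₁ U₂` over all decompositions `U = U₁ ++ U₂`. -/
def splitSum {A N : Type*} [AddCommMonoid N] : List A → (List A → List A → N) → N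
  | [], g => g [] []
  | a :: U, g => g [] (a :: U) + splitSum U fun U₁ U₂ => g (a :: U₁) U₂

section splitSum

variable {A B N : Type*} [AddCommMonoid N]

@[simp] theorem splitSum_nil (g : List A → List A → N) : splitSum [] g = g [] [] := rfl

@[simp] theorem splitSum_cons (a : A) (U : List A) (g : List A → List A → N) :
    splitSum (a :: U) g = g [] (a :: U) + splitSum U fun U₁ U₂ => g (a :: U₁) U₂ := rfl

theorem splitSum_congr {U : List A} {g g' : List A → List A → N}
    (h : ∀ U₁ U₂, U₁ ++ U₂ = U → g U₁ U₂ = g' U₁ U₂) : splitSum U g = splitSum U g' := by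
  induction U generalizing g g' with
  | nil => exact h _ _ rfl
  | cons a U ih =>
    rw [splitSum_cons, splitSum_cons, h [] (a :: U) rfl,
      ih fun U₁ U₂ e => h (a :: U₁) U₂ (by rw [List.cons_append, e])]

@[simp] theorem splitSum_zero (U : List A) : splitSum U (fun _ _ => (0 : N)) = 0 := by
  induction U with
  | nil => rfl
  | cons a U ih => simp [ih]

theorem splitSum_eq_zero {U : List A} {g : List A → List A → N}
    (h : ∀ U₁ U₂, U₁ ++ U₂ = U → g U₁ U₂ = 0) : splitSum U g = 0 :=
  (splitSum_congr h).trans (splitSum_zero U)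

theorem splitSum_add (U : List A) (g g' : List A → List A → N) :
    splitSum U (fun x y => g x y + g' x y) = splitSum U g + splitSum U g' := by
  induction U generalizing g g' with
  | nil => rfl
  | cons a U ih => simp only [splitSum_cons, ih]; abel

theorem map_splitSum {N' F : Type*} [AddCommMonoid N'] [FunLike F N N'] [AddMonoidHomClass F N N']
    (φ : F) (U : List A) (g : List A → List A → N) :
    φ (splitSum U g) = splitSum U fun x y => φ (g x y) := by
  induction U generalizing g with
  | nil => rfl
  | cons a U ih => simp only [splitSum_cons, map_add, ih]

theorem splitSum_map (i : A → B) (U : List A) (g : List B → List B → N) :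
    splitSum (U.map i) g = splitSum U fun x y => g (x.map i) (y.map i) := by
  induction U generalizing g with
  | nil => rfl
  | cons a U ih => simp only [List.map_cons, splitSum_cons, ih, List.map_nil]

theorem splitSum_comm (U : List A) (V : List B) (g : List A → List A → List B → List B → N) :
    (splitSum U fun a b => splitSum V fun c d => g a b c d) =
      splitSum V fun c d => splitSum U fun a b => g a b c d := by
  induction U generalizing g with
  | nil => rfl
  | cons a U ih => simp only [splitSum_cons, ih, splitSum_add]

/-- Coassociativity of deconcatenation. -/
theorem splitSum_assoc (U : List A) (g : List A → List A → List A → N) :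
    (splitSum U fun x y => splitSum x fun a b => g a b y) =
      splitSum U fun a y => splitSum y fun b c => g a b c := by
  induction U generalizing g with
  | nil => rfl
  | cons a U ih =>
    simp only [splitSum_cons, splitSum_nil, splitSum_add]
    rw [ih fun x y z => g (a :: x) y z]
    abel

theorem splitSum_mul {R : Type*} [NonUnitalNonAssocSemiring R] (U : List A)
    (g : List A → List A → R) (r : R) :
    splitSum U g * r = splitSum U fun x y => g x y * r :=
  map_splitSum (AddMonoidHom.mulRight r) U g

theorem mul_splitSum {R : Type*} [NonUnitalNonAssocSemiring R] (U : List A)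
    (g : List A → List A → R) (r : R) :
    r * splitSum U g = splitSum U fun x y => r * g x y :=
  map_splitSum (AddMonoidHom.mulLeft r) U g

theorem splitSum_apply {α R : Type*} [AddCommMonoid R] (U : List A)
    (g : List A → List A → α →₀ R) (x : α) :
    splitSum U g x = splitSum U fun a b => g a b x :=
  map_splitSum (Finsupp.applyAddHom x) U g

/-- The bridge from words to power series: a summand that sees only lengths gives a Cauchy product.
-/
theorem splitSum_antidiagonal (U : List A) (g : ℕ → ℕ → N) :
    (splitSum U fun x y => g x.length y.length) =
      ∑ p ∈ antidiagonal U.length, g p.1 p.2 := by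
  induction U generalizing g with
  | nil => simp
  | cons a U ih =>
    simp only [splitSum_cons, List.length_cons, List.length_nil]
    rw [ih fun i j => g (i + 1) j, Finset.Nat.sum_antidiagonal_succ]

/-- Only the decompositions with `U₁ = []`, when the summand vanishes on all the others. -/
theorem splitSum_eq_first {U : List A} {g : List A → List A → N}
    (h : ∀ a U₁ U₂, g (a :: U₁) U₂ = 0) : splitSum U g = g [] U := by
  cases U with
  | nil => rfl
  | cons a U => rw [splitSum_cons, splitSum_eq_zero fun U₁ U₂ _ => h a U₁ U₂, add_zero]

end splitSum

/-! ### The quasi-shuffle as a sum over pairs of decompositions into blocks -/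

/-- The weight of a nonempty pair of blocks of lengths `a` and `b`. -/
def blockWeight {R : Type*} [CommSemiring R] (α β : R) (a b : ℕ) : R :=
  if a = 0 ∧ b = 0 then 0 else factor α β a b

section quasiShuffle

variable {R A : Type*} [CommSemiring R]

@[simp] theorem blockWeight_zero_zero (α β : R) : blockWeight α β 0 0 = 0 := by
  simp [blockWeight]

theorem blockWeight_zero_succ (α β : R) (b : ℕ) :
    blockWeight α β 0 (b + 1) = if b = 0 then 1 else 0 := by
  rcases b with _ | b <;> simp [blockWeight, factor]

theorem blockWeight_succ_zero (α β : R) (b : ℕ) :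
    blockWeight α β (b + 1) 0 = if b = 0 then 1 else 0 := by
  rcases b with _ | b <;> simp [blockWeight, factor]

/-- The coefficient form of `F = x + y + α x y + β x y F`. The two terms on the right match the `α`
and `β` terms of the quasi-shuffle recursion. -/
theorem blockWeight_succ_succ (α β : R) (a b : ℕ) :
    blockWeight α β (a + 1) (b + 1) =
      (if a = 0 ∧ b = 0 then α else 0) + β * blockWeight α β a b := by
  rcases a with _ | a <;> rcases b with _ | b
  · simp [blockWeight, factor]
  · rcases b with _ | b <;> simp [blockWeight, factor]
  · rcases a with _ | a <;> simp [blockWeight, factor]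
  · simp only [blockWeight, factor]
    simp only [Nat.add_eq_zero_iff, one_ne_zero, and_false, if_false, add_left_inj,
      Nat.add_sub_cancel, zero_add, mul_ite, mul_zero, Nat.add_min_add_right, pow_succ]
    split_ifs <;> ring

theorem zeta_add [Add A] (x : A) (F G : List A →₀ R) :
    zeta x (F + G) = zeta x F + zeta x G :=
  Finsupp.sum_add_index' (by rintro (_ | _) <;> simp) (by rintro (_ | _) <;> simp)

/-- `zeta x` as an additive map. -/
def zetaHom [Add A] (x : A) : (List A →₀ R) →+ (List A →₀ R) where
  toFun := zeta x
  map_zero' := Finsupp.sum_zero_index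
  map_add' := zeta_add x

theorem zeta_single_nil [Add A] (x : A) (r : R) : zeta x (Finsupp.single [] r) = 0 :=
  Finsupp.sum_single_index rfl

theorem zeta_single_cons [Add A] (x a : A) (w : List A) (r : R) :
    zeta x (Finsupp.single (a :: w) r) = Finsupp.single ((x + a) :: w) r :=
  Finsupp.sum_single_index (by simp)

theorem zeta_smul [Add A] (x : A) (r : R) (F : List A →₀ R) :
    zeta x (r • F) = r • zeta x F := by
  induction F using Finsupp.induction_linear with
  | zero => simp [zeta]
  | add F G hF hG => rw [smul_add, zeta_add, hF, hG, zeta_add, smul_add]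
  | single w c =>
    rcases w with _ | ⟨a, w⟩
    · rw [Finsupp.smul_single, zeta_single_nil, zeta_single_nil, smul_zero]
    · rw [Finsupp.smul_single, zeta_single_cons, zeta_single_cons, Finsupp.smul_single]

theorem zeta_cons [Add A] (x a : A) (F : List A →₀ R) :
    zeta x (cons a F) = cons (x + a) F := by
  induction F using Finsupp.induction_linear with
  | zero => simp [zeta, cons]
  | add F G hF hG =>
    simp only [cons, Finsupp.mapDomain_add, zeta_add] at hF hG ⊢
    rw [hF, hG]
  | single w c =>
    simp only [cons, Finsupp.mapDomain_single]
    exact zeta_single_cons x a w c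

/-- Induction on pairs of lists, for statements about block decompositions. -/
theorem blockInduction {p : List A → List A → Prop}
    (h : ∀ U V, (∀ U₁ U₂ V₁ V₂, U₁ ++ U₂ = U → V₁ ++ V₂ = V →
      ¬(U₁.length = 0 ∧ V₁.length = 0) → p U₂ V₂) → p U V) (U V : List A) : p U V := by
  induction hn : U.length + V.length using Nat.strong_induction_on generalizing U V with
  | _ n ih =>
    refine h U V fun U₁ U₂ V₁ V₂ hU hV h0 => ih (U₂.length + V₂.length) ?_ U₂ V₂ rfl
    subst hU hV
    simp only [List.length_append] at hn
    omega

variable [AddCommMonoid A]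

open Classical in
/-- The quasi-shuffle, by its first pair of blocks. -/
theorem quasiShuffle_eq (α β : R) (U V : List A) :
    quasiShuffle α β U V = (if U = [] ∧ V = [] then Finsupp.single [] 1 else 0) +
      splitSum U fun U₁ U₂ => splitSum V fun V₁ V₂ =>
        blockWeight α β U₁.length V₁.length •
          cons (U₁.sum + V₁.sum) (quasiShuffle α β U₂ V₂) := by
  have hcons : ∀ (a : A) (w : List A),
      cons a (Finsupp.single w (1 : R)) = Finsupp.single (a :: w) 1 := fun a w => by
    simp [cons, Finsupp.mapDomain_single]
  -- A block that takes letters from one word only has nonzero weight only if it is a single letter;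
  -- these blocks give the two shuffle terms of the recursion.
  have hl : ∀ (b : A) (U V : List A), (splitSum V fun V₁ V₂ =>
        blockWeight α β 0 (b :: V₁).length •
          cons (([] : List A).sum + (b :: V₁).sum) (quasiShuffle α β U V₂)) =
      cons b (quasiShuffle α β U V) := fun b U V => by
    rw [splitSum_eq_first]
    · simp [blockWeight_zero_succ]
    · simp [blockWeight_zero_succ]
  have hr : ∀ (b : A) (U V : List A), (splitSum U fun U₁ U₂ =>
        blockWeight α β (b :: U₁).length 0 •
          cons ((b :: U₁).sum + ([] : List A).sum) (quasiShuffle α β U₂ V)) =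
      cons b (quasiShuffle α β U V) := fun b U V => by
    rw [splitSum_eq_first]
    · simp [blockWeight_succ_zero]
    · simp [blockWeight_succ_zero]
  have hnil : ∀ V : List A, quasiShuffle α β [] V = Finsupp.single V (1 : R) := fun V => by
    rw [quasiShuffle]
  have hnil' : ∀ V : List A, quasiShuffle α β V [] = Finsupp.single V (1 : R) := fun V => by
    cases V <;> rw [quasiShuffle]
  induction U generalizing V with
  | nil =>
    cases V with
    | nil => simp [hnil]
    | cons b V =>
      have := hl b [] V
      simp only [splitSum_nil, splitSum_cons]
      rw [List.length_nil, this]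
      simp [hnil, hcons]
  | cons a U ih =>
    cases V with
    | nil =>
      have := hr a U []
      simp only [splitSum_nil, splitSum_cons]
      rw [List.length_nil, this]
      simp [hnil', hcons]
    | cons b V =>
      -- In the expansion of `U ⋆ V`, the operator `ζ` enlarges the first pair of blocks by `a` and
      -- `b`, and it kills the empty word.
      have e : zeta (a + b) (quasiShuffle α β U V) = splitSum U fun U₁ U₂ =>
          splitSum V fun V₁ V₂ => blockWeight α β U₁.length V₁.length •
            cons ((a :: U₁).sum + (b :: V₁).sum) (quasiShuffle α β U₂ V₂) := by
        conv_lhs => rw [ih V]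
        rw [zeta_add]
        have h0 : zeta (a + b) (if U = [] ∧ V = [] then Finsupp.single [] (1 : R) else 0) = 0 := by
          split_ifs
          · exact zeta_single_nil _ _
          · exact Finsupp.sum_zero_index
        rw [h0, zero_add]
        change zetaHom (a + b) _ = _
        rw [map_splitSum]
        refine splitSum_congr fun U₁ U₂ _ => ?_
        rw [map_splitSum]
        refine splitSum_congr fun V₁ V₂ _ => ?_
        change zeta (a + b) _ = _
        rw [zeta_smul, zeta_cons, List.sum_cons, List.sum_cons, add_add_add_comm]
      -- The `α` part of the weight recursion survives only for the blocks `[a]` and `[b]`.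
      have e' : (splitSum U fun U₁ U₂ => splitSum V fun V₁ V₂ =>
          (if U₁.length = 0 ∧ V₁.length = 0 then α else 0) •
            cons ((a :: U₁).sum + (b :: V₁).sum) (quasiShuffle α β U₂ V₂)) =
          α • cons (a + b) (quasiShuffle α β U V) := by
        rw [splitSum_eq_first, splitSum_eq_first]
        · simp
        · simp
        · intro a U₁ U₂
          exact splitSum_eq_zero (by simp)
      rw [quasiShuffle, e, ← e']
      simp only [splitSum_cons, List.length_cons, List.length_nil, blockWeight_succ_succ, add_smul,
        splitSum_add, mul_smul, blockWeight_zero_zero, zero_smul]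
      have h1 := hl b (a :: U) V
      have h2 := hr a U (b :: V)
      simp only [List.length_cons] at h1 h2
      rw [h1, h2]
      simp only [reduceCtorEq, and_self, if_false, zero_add]
      have h3 : ∀ g : List A → List A → List A → List A → List A →₀ R,
          (β • splitSum U fun U₁ U₂ => splitSum V fun V₁ V₂ => g U₁ U₂ V₁ V₂) =
            splitSum U fun U₁ U₂ => splitSum V fun V₁ V₂ => β • g U₁ U₂ V₁ V₂ := by
        intro g
        have := map_splitSum (DistribSMul.toAddMonoidHom (List A →₀ R) β) U fun U₁ U₂ =>
          splitSum V fun V₁ V₂ => g U₁ U₂ V₁ V₂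
        refine this.trans (splitSum_congr fun U₁ U₂ _ => ?_)
        exact map_splitSum (DistribSMul.toAddMonoidHom (List A →₀ R) β) V fun V₁ V₂ =>
          g U₁ U₂ V₁ V₂
      rw [h3]
      abel

/-- The value on a quasi-shuffle of the linear form that extends `g`. -/
def shuffleEval (α β : R) (U V : List A) (g : List A → R) : R :=
  Finsupp.linearCombination R g (quasiShuffle α β U V)

open Classical in
theorem shuffleEval_eq (α β : R) (U V : List A) (g : List A → R) :
    shuffleEval α β U V g = (if U = [] ∧ V = [] then g [] else 0) +
      splitSum U fun U₁ U₂ => splitSum V fun V₁ V₂ =>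
        blockWeight α β U₁.length V₁.length *
          shuffleEval α β U₂ V₂ fun P => g ((U₁.sum + V₁.sum) :: P) := by
  rw [shuffleEval, quasiShuffle_eq, map_add, map_splitSum]
  congr 1
  · split_ifs <;> simp
  · refine splitSum_congr fun U₁ U₂ _ => ?_
    rw [map_splitSum]
    refine splitSum_congr fun V₁ V₂ _ => ?_
    rw [map_smul, smul_eq_mul, cons, Finsupp.linearCombination_mapDomain]
    rfl

theorem shuffleEval_add (α β : R) (U V : List A) (g g' : List A → R) :
    shuffleEval α β U V (fun P => g P + g' P) =
      shuffleEval α β U V g + shuffleEval α β U V g' := by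
  simp only [shuffleEval, Finsupp.linearCombination_apply, Finsupp.sum, smul_eq_mul, mul_add,
    sum_add_distrib]

theorem shuffleEval_mul (α β : R) (U V : List A) (g : List A → R) (r : R) :
    shuffleEval α β U V (fun P => g P * r) = shuffleEval α β U V g * r := by
  simp only [shuffleEval, Finsupp.linearCombination_apply, Finsupp.sum, smul_eq_mul, ← mul_assoc,
    sum_mul]

theorem shuffleEval_congr {α β : R} {U V : List A} {g g' : List A → R}
    (h : ∀ P ∈ (quasiShuffle α β U V).support, g P = g' P) :
    shuffleEval α β U V g = shuffleEval α β U V g' := by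
  simp only [shuffleEval, Finsupp.linearCombination_apply]
  exact Finsupp.sum_congr fun P hP => by rw [h P hP]

/-- Deconcatenation is a morphism for the quasi-shuffle. -/
theorem shuffleEval_splitSum (α β : R) (U V : List A) (g : List A → List A → R) :
    shuffleEval α β U V (fun P => splitSum P g) =
      splitSum U fun U₁ U₂ => splitSum V fun V₁ V₂ =>
        shuffleEval α β U₁ V₁ fun P => shuffleEval α β U₂ V₂ fun Q => g P Q := by
  classical
  induction U, V using blockInduction generalizing g with
  | h U V ih =>
    rw [shuffleEval_eq]
    simp only [splitSum_cons, splitSum_nil, shuffleEval_add, mul_add, splitSum_add]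
    -- The terms with empty left factor reassemble into the value of `g []` on all of `U ⋆ V`; on
    -- the other side they match `U₁ = V₁ = []`.
    rw [← add_assoc, ← shuffleEval_eq α β U V fun Q => g [] Q]
    have h1 : ∀ U₁ U₂ V₁ V₂, shuffleEval α β U₁ V₁
        (fun P => shuffleEval α β U₂ V₂ fun Q => g P Q) =
        (if U₁ = [] ∧ V₁ = [] then shuffleEval α β U₂ V₂ fun Q => g [] Q else 0) +
        splitSum U₁ fun U₃ U₄ => splitSum V₁ fun V₃ V₄ =>
        blockWeight α β U₃.length V₃.length *
          shuffleEval α β U₄ V₄ fun P => shuffleEval α β U₂ V₂ fun Q =>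
            g ((U₃.sum + V₃.sum) :: P) Q := fun U₁ U₂ V₁ V₂ => shuffleEval_eq ..
    simp only [h1, splitSum_add]
    congr 1
    · rw [splitSum_eq_first, splitSum_eq_first]
      · simp
      · simp
      · intro a U₁ U₂
        exact splitSum_eq_zero (by simp)
    -- By coassociativity the first pair of blocks can be chosen before the cut into left and right
    -- factors, which leaves the statement for the shorter remaining words.
    · have h2 : ∀ U₁ U₂, (splitSum V fun V₁ V₂ => splitSum U₁ fun U₃ U₄ => splitSum V₁ fun V₃ V₄ =>
          blockWeight α β U₃.length V₃.length *
          shuffleEval α β U₄ V₄ fun P => shuffleEval α β U₂ V₂ fun Q =>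
            g ((U₃.sum + V₃.sum) :: P) Q) = splitSum U₁ fun U₃ U₄ => splitSum V fun V₃ y =>
          splitSum y fun V₄ V₂ => blockWeight α β U₃.length V₃.length *
          shuffleEval α β U₄ V₄ fun P => shuffleEval α β U₂ V₂ fun Q =>
            g ((U₃.sum + V₃.sum) :: P) Q := fun U₁ U₂ => by
        rw [splitSum_comm]
        exact splitSum_congr fun U₃ U₄ _ => splitSum_assoc V fun V₃ V₄ V₂ =>
          blockWeight α β U₃.length V₃.length *
          shuffleEval α β U₄ V₄ fun P => shuffleEval α β U₂ V₂ fun Q =>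
            g ((U₃.sum + V₃.sum) :: P) Q
      simp only [h2]
      rw [splitSum_assoc U fun U₃ U₄ U₂ => splitSum V fun V₃ y =>
          splitSum y fun V₄ V₂ => blockWeight α β U₃.length V₃.length *
          shuffleEval α β U₄ V₄ fun P => shuffleEval α β U₂ V₂ fun Q =>
            g ((U₃.sum + V₃.sum) :: P) Q]
      refine splitSum_congr fun U₁ U₂ hU => ?_
      rw [splitSum_comm]
      refine splitSum_congr fun V₁ V₂ hV => ?_
      simp only [← mul_splitSum]
      by_cases h0 : U₁.length = 0 ∧ V₁.length = 0
      · rw [h0.1, h0.2, blockWeight_zero_zero, zero_mul, zero_mul]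
      · rw [ih U₁ U₂ V₁ V₂ hU hV h0]

/-- Words that occur in a quasi-shuffle have the right sum, and inherit the nonvanishing of letters
from the factors. -/
theorem quasiShuffle_support {α β : R} (hA : ∀ a b : A, a + b = 0 → a = 0 ∧ b = 0)
    {U V P : List A} (hP : P ∈ (quasiShuffle α β U V).support) :
    P.sum = U.sum + V.sum ∧ ((∀ a ∈ U, a ≠ 0) → (∀ a ∈ V, a ≠ 0) → ∀ a ∈ P, a ≠ 0) := by
  classical
  have hsum : ∀ U : List A, U.sum = 0 → ∀ a ∈ U, a = 0 := by
    intro U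
    induction U with
    | nil => simp
    | cons a U ih =>
      intro h
      obtain ⟨h1, h2⟩ := hA _ _ (List.sum_cons.symm.trans h)
      simpa [h1] using ih h2
  induction U, V using blockInduction generalizing P with
  | h U V ih =>
    by_contra hne
    refine Finsupp.mem_support_iff.1 hP ?_
    rw [quasiShuffle_eq, Finsupp.add_apply]
    have h1 : (if U = [] ∧ V = [] then Finsupp.single [] (1 : R) else 0) P = 0 := by
      split_ifs with h
      · obtain ⟨rfl, rfl⟩ := h
        refine Finsupp.single_eq_of_ne fun h => hne ?_
        subst h
        simp
      · rfl
    rw [h1, zero_add, splitSum_apply]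
    refine splitSum_eq_zero fun U₁ U₂ hU => ?_
    rw [splitSum_apply]
    refine splitSum_eq_zero fun V₁ V₂ hV => ?_
    rw [Finsupp.smul_apply, smul_eq_mul]
    by_cases h0 : U₁.length = 0 ∧ V₁.length = 0
    · rw [h0.1, h0.2, blockWeight_zero_zero, zero_mul]
    · by_cases h2 : P ∈ Set.range (List.cons (U₁.sum + V₁.sum))
      · obtain ⟨Q, rfl⟩ := h2
        rw [cons, Finsupp.mapDomain_apply List.cons_injective]
        by_contra h3
        obtain ⟨h4, h5⟩ := ih U₁ U₂ V₁ V₂ hU hV h0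
          (Finsupp.mem_support_iff.2 (right_ne_zero_of_mul h3))
        refine hne ⟨?_, fun hU' hV' => ?_⟩
        · rw [List.sum_cons, h4, ← hU, ← hV, List.sum_append, List.sum_append,
            add_add_add_comm]
        · rw [← hU] at hU'
          rw [← hV] at hV'
          simp only [List.mem_append] at hU' hV'
          simp only [List.mem_cons, forall_eq_or_imp]
          -- A zero first letter would force every letter of both blocks to be zero, so both blocks
          -- would be empty, and that pair has weight `0`.
          refine ⟨fun h => h0 ?_, h5 (fun a ha => hU' a (.inr ha)) fun a ha => hV' a (.inr ha)⟩
          obtain ⟨h6, h7⟩ := hA _ _ h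
          simp only [List.length_eq_zero_iff, List.eq_nil_iff_forall_not_mem]
          exact ⟨fun a ha => hU' a (.inl ha) (hsum _ h6 a ha),
            fun a ha => hV' a (.inl ha) (hsum _ h7 a ha)⟩
      · rw [cons, Finsupp.mapDomain_of_notMem_range _ _ h2, mul_zero]

end quasiShuffle

/-! ### Contraction of a word along a coarser one -/

open Classical in
/-- The sum, over the decompositions of `P` into blocks with sums the letters of `W`, of the
product of the values of `h` at the lengths of the blocks. -/
def contract {R A : Type*} [CommSemiring R] [AddCommMonoid A] (h : ℕ → R) :
    List A → List A → R
  | P, [] => if P = [] then 1 else 0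
  | P, q :: W => splitSum P fun P₁ P₂ => if P₁.sum = q then h P₁.length * contract h P₂ W else 0

open Classical in
/-- The same with pairs of words. -/
def contractPair {R A B : Type*} [CommSemiring R] [AddCommMonoid A] [AddCommMonoid B]
    (ω : ℕ → ℕ → R) : List A → List B → List (A × B) → R
  | U, V, [] => if U = [] ∧ V = [] then 1 else 0
  | U, V, q :: W => splitSum U fun U₁ U₂ => splitSum V fun V₁ V₂ =>
      if U₁.sum = q.1 ∧ V₁.sum = q.2 then ω U₁.length V₁.length * contractPair ω U₂ V₂ W else 0

theorem quasiShuffle_apply_nil {R A : Type*} [CommSemiring R] [AddCommMonoid A] (α β : R)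
    (U V : List A) [Decidable (U = [] ∧ V = [])] :
    quasiShuffle α β U V [] = if U = [] ∧ V = [] then 1 else 0 := by
  rw [quasiShuffle_eq, Finsupp.add_apply, splitSum_apply, splitSum_eq_zero, add_zero]
  · split_ifs <;> simp
  · intro U₁ U₂ _
    rw [splitSum_apply]
    refine splitSum_eq_zero fun V₁ V₂ _ => ?_
    rw [Finsupp.smul_apply, cons, Finsupp.mapDomain_of_notMem_range, smul_zero]
    simp

section embed

variable {R A B D : Type*} [CommSemiring R] [AddCommMonoid A] [AddCommMonoid B] [AddCommMonoid D]
  (i₁ : A →+ D) (i₂ : B →+ D)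

/-- The coefficients of a quasi-shuffle of words in independent letters. -/
theorem quasiShuffle_apply
    (hi : ∀ a b a' b', i₁ a + i₂ b = i₁ a' + i₂ b' → a = a' ∧ b = b')
    (α β : R) (U : List A) (V : List B) (W : List (A × B)) :
    quasiShuffle α β (U.map i₁) (V.map i₂) (W.map fun p => i₁ p.1 + i₂ p.2) =
      contractPair (blockWeight α β) U V W := by
  classical
  induction W generalizing U V with
  | nil =>
    rw [List.map_nil, quasiShuffle_apply_nil, contractPair]
    simp
  | cons q W ih =>
    rw [quasiShuffle_eq, Finsupp.add_apply, splitSum_apply, splitSum_map, contractPair]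
    have h1 : (if U.map i₁ = [] ∧ V.map i₂ = [] then Finsupp.single [] (1 : R) else 0)
        ((q :: W).map fun p => i₁ p.1 + i₂ p.2) = 0 := by
      split_ifs <;> simp
    rw [h1, zero_add]
    refine splitSum_congr fun U₁ U₂ _ => ?_
    rw [splitSum_apply, splitSum_map]
    refine splitSum_congr fun V₁ V₂ _ => ?_
    rw [Finsupp.smul_apply, smul_eq_mul, ← map_list_sum, ← map_list_sum, List.map_cons, cons]
    split_ifs with h
    · rw [h.1, h.2, Finsupp.mapDomain_apply List.cons_injective, ih, List.length_map,
        List.length_map]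
    · rw [Finsupp.mapDomain_of_notMem_range, mul_zero]
      rintro ⟨Q, hQ⟩
      exact h (hi _ _ _ _ (List.cons.inj hQ).1)

/-- Contraction along `W` cuts `P` into blocks with prescribed sums and applies `h` to each length.
Deconcatenation passes through the quasi-shuffle, `hh` makes each block multiplicative, and `hi`
splits each condition on sums into one condition per word. -/
theorem shuffleEval_contract
    (hi : ∀ a b a' b', i₁ a + i₂ b = i₁ a' + i₂ b' → a = a' ∧ b = b')
    (hD : ∀ a b : D, a + b = 0 → a = 0 ∧ b = 0) (α β : R) (h : ℕ → R)
    (hh : ∀ U V : List D, shuffleEval α β U V (fun P => h P.length) = h U.length * h V.length)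
    (U : List A) (V : List B) (W : List (A × B)) :
    shuffleEval α β (U.map i₁) (V.map i₂) (fun P => contract h P (W.map fun p => i₁ p.1 + i₂ p.2)) =
      contract h U (W.map Prod.fst) * contract h V (W.map Prod.snd) := by
  classical
  induction W generalizing U V with
  | nil =>
    simp only [List.map_nil, contract]
    have : (fun P : List D => if P = [] then (1 : R) else 0) = Pi.single [] 1 := by
      ext P; simp [Pi.single_apply]
    rw [shuffleEval, this]
    have h2 : ∀ F : List D →₀ R, Finsupp.linearCombination R (Pi.single [] 1) F = F [] := by
      intro F
      rw [Finsupp.linearCombination_apply, Finsupp.sum_eq_single []]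
      · simp
      · intro b _ hb
        simp [hb]
      · simp
    rw [h2, quasiShuffle_apply_nil]
    simp only [List.map_eq_nil_iff]
    split_ifs <;> simp_all
  | cons q W ih =>
    simp only [List.map_cons, contract]
    rw [shuffleEval_splitSum, splitSum_map, splitSum_mul]
    refine splitSum_congr fun U₁ U₂ _ => ?_
    rw [splitSum_map, mul_splitSum]
    refine splitSum_congr fun V₁ V₂ _ => ?_
    -- All words occurring in a quasi-shuffle have the same sum, so the condition on `P.sum` is
    -- constant and can be taken out.
    have e : shuffleEval α β (U₁.map i₁) (V₁.map i₂) (fun P => shuffleEval α β (U₂.map i₁)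
          (V₂.map i₂) fun Q => if P.sum = i₁ q.1 + i₂ q.2 then
            h P.length * contract h Q (W.map fun p => i₁ p.1 + i₂ p.2) else 0) =
        shuffleEval α β (U₁.map i₁) (V₁.map i₂) (fun P => h P.length *
          (if U₁.sum = q.1 ∧ V₁.sum = q.2 then
            contract h U₂ (W.map Prod.fst) * contract h V₂ (W.map Prod.snd) else 0)) := by
      refine shuffleEval_congr fun P hP => ?_
      have := (quasiShuffle_support hD hP).1
      rw [← map_list_sum, ← map_list_sum] at this
      have e1 : P.sum = i₁ q.1 + i₂ q.2 ↔ U₁.sum = q.1 ∧ V₁.sum = q.2 := by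
        rw [this]
        exact ⟨hi _ _ _ _, fun h => by rw [h.1, h.2]⟩
      simp only [e1]
      rw [← ih]
      split_ifs
      · simp only [mul_comm (h P.length)]
        exact shuffleEval_mul ..
      · rw [mul_zero]
        simp [shuffleEval, Finsupp.linearCombination_apply]
    rw [e, shuffleEval_mul, hh, List.length_map, List.length_map]
    by_cases h1 : U₁.sum = q.1 <;> by_cases h2 : V₁.sum = q.2
    · rw [if_pos ⟨h1, h2⟩, if_pos h1, if_pos h2]
      ring
    all_goals simp [h1, h2]

end embed

/-! ### The exponential of the formal group law -/

/-- The coefficients of the series `H` with `H' (1 + α y + β y ^ 2) = H` and `H(0) = 1`. -/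
def expCoeff {K : Type*} [Field K] (α β : K) : ℕ → K
  | 0 => 1
  | 1 => 1
  | k + 2 => (expCoeff α β (k + 1) - α * (k + 1) * expCoeff α β (k + 1) -
      β * k * expCoeff α β k) / (k + 2)

/-- The coefficient of `y ^ (k + 1)` in `H' (1 + α y + β y ^ 2) = H`. -/
theorem expCoeff_rec {K : Type*} [Field K] [CharZero K] (α β : K) (k : ℕ) :
    (k + 2) * expCoeff α β (k + 2) + α * (k + 1) * expCoeff α β (k + 1) +
      β * k * expCoeff α β k = expCoeff α β (k + 1) := by
  have : (k + 2 : K) ≠ 0 := by exact_mod_cast (Nat.succ_ne_zero (k + 1))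
  rw [expCoeff]
  field_simp
  ring

section groupLaw

open PowerSeries

variable {K : Type*} [Field K]

/-- The formal group law `(x + y + α x y) / (1 - β x y)` as a series in `x` over `K⟦y⟧`. -/
def groupLaw (α β : K) : PowerSeries (PowerSeries K) :=
  .mk fun i => .mk fun j => blockWeight α β i j

theorem groupLaw_mul (α β : K) :
    groupLaw α β * (1 - C (C β * PowerSeries.X) * PowerSeries.X) =
      PowerSeries.X + C PowerSeries.X + C (C α * PowerSeries.X) * PowerSeries.X := by
  ext i j
  rw [mul_sub, mul_one, ← mul_assoc, mul_comm (groupLaw α β)]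
  rcases i with _ | i
  · simp only [map_sub, coeff_zero_mul_X, map_add, coeff_zero_C, groupLaw, coeff_mk, sub_zero,
      coeff_zero_X, zero_add, add_zero]
    rcases j with _ | j
    · simp
    · simp [blockWeight_zero_succ, coeff_X]
  · simp only [map_sub, map_add, coeff_succ_mul_X, groupLaw, coeff_mk, mul_assoc, coeff_C_mul,
      coeff_succ_C, add_zero]
    rcases j with _ | j
    · rw [coeff_zero_X_mul, blockWeight_succ_zero]
      rcases i with _ | i
      · simp
      · simp [coeff_X]
    · rw [coeff_succ_X_mul, blockWeight_succ_succ]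
      rcases i with _ | i
      · rcases j with _ | j <;> simp [coeff_X, coeff_one]
      · simp [coeff_X]

/-- Invariance of the differential `dx / (1 + α x + β x ^ 2)` under translation by `y`. -/
theorem groupLaw_derivative (α β : K) :
    (1 + C (C α) * PowerSeries.X + C (C β) * PowerSeries.X ^ 2) * d⁄dX _ (groupLaw α β) =
      1 + C (C α) * groupLaw α β + C (C β) * groupLaw α β ^ 2 := by
  have h := groupLaw_mul α β
  have h' := congrArg (d⁄dX _) h
  have hQ : (1 - C (C β * PowerSeries.X) * PowerSeries.X : PowerSeries (PowerSeries K)) ≠ 0 := by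
    intro h0
    have := congrArg constantCoeff h0
    simp at this
  simp only [Derivation.leibniz, map_sub, map_add, Derivation.map_one_eq_zero, derivative_C,
    derivative_X, smul_eq_mul, mul_zero, add_zero, mul_one, zero_sub] at h'
  simp only [map_mul] at h h' hQ
  -- After multiplication by the square of the denominator `1 - β x y`, only the equation for `F`
  -- and its derivative are needed.
  refine mul_right_cancel₀ (pow_ne_zero 2 hQ) ?_
  generalize groupLaw α β = F at *
  generalize d⁄dX _ F = F' at *
  generalize (C (C α) : PowerSeries (PowerSeries K)) = a at *
  generalize (C (C β) : PowerSeries (PowerSeries K)) = b at *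
  generalize (C PowerSeries.X : PowerSeries (PowerSeries K)) = y at *
  generalize (PowerSeries.X : PowerSeries (PowerSeries K)) = x at *
  linear_combination (1 + a * x + b * x ^ 2) * (1 - b * y * x) * h' +
    ((1 + a * x + b * x ^ 2) * (b * y) - a * (1 - b * y * x) -
      b * (F * (1 - b * y * x) + (x + y + a * y * x))) * h

/-! ### The identity `H(F(x, y)) = H(x) H(y)`, degree by degree. -/

theorem coeff_groupLaw_pow_succ (α β : K) (l a b : ℕ) :
    coeff b (coeff a (groupLaw α β ^ (l + 1))) = ∑ p ∈ antidiagonal a, ∑ q ∈ antidiagonal b,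
      blockWeight α β p.1 q.1 * coeff q.2 (coeff p.2 (groupLaw α β ^ l)) := by
  simp only [pow_succ', coeff_mul, map_sum, groupLaw, coeff_mk]

theorem coeff_groupLaw_pow_eq_zero (α β : K) {l a b : ℕ} (h : a + b < l) :
    coeff b (coeff a (groupLaw α β ^ l)) = 0 := by
  induction l generalizing a b with
  | zero => omega
  | succ l ih =>
    rw [coeff_groupLaw_pow_succ]
    refine sum_eq_zero fun p hp => sum_eq_zero fun q hq => ?_
    rw [HasAntidiagonal.mem_antidiagonal] at hp hq
    by_cases h0 : p.1 = 0 ∧ q.1 = 0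
    · rw [h0.1, h0.2, blockWeight_zero_zero, zero_mul]
    · rw [ih (by omega), mul_zero]

/-- `H(F)` is replaced by a partial sum. By `expCoeff_rec` it satisfies the differential equation of
`H` up to multiples of `F ^ (L + 1)` and `F ^ (L + 2)`, which vanish in total degree at most `L`. -/
theorem derivative_partialExp [CharZero K] (α β : K) (L : ℕ) :
    (1 + C (C α) * PowerSeries.X + C (C β) * PowerSeries.X ^ 2) *
        d⁄dX _ (∑ l ∈ range (L + 2), C (C (expCoeff α β l)) * groupLaw α β ^ l) =
      (∑ l ∈ range (L + 1), C (C (expCoeff α β l)) * groupLaw α β ^ l) +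
        C (C (α * (L + 1) * expCoeff α β (L + 1) + β * L * expCoeff α β L)) *
          groupLaw α β ^ (L + 1) +
        C (C (β * (L + 1) * expCoeff α β (L + 1))) * groupLaw α β ^ (L + 2) := by
  have key : ∀ l, (1 + C (C α) * PowerSeries.X + C (C β) * PowerSeries.X ^ 2) *
      d⁄dX _ (C (C (expCoeff α β (l + 1))) * groupLaw α β ^ (l + 1)) =
      C (C (expCoeff α β (l + 1) * (l + 1))) * (groupLaw α β ^ l +
        C (C α) * groupLaw α β ^ (l + 1) + C (C β) * groupLaw α β ^ (l + 2)) := by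
    intro l
    simp only [Derivation.leibniz, derivative_C, derivative_pow, smul_eq_mul,
      Nat.add_sub_cancel]
    have := groupLaw_derivative α β
    simp only [map_mul, map_add, map_natCast, map_one]
    push_cast
    linear_combination (C (C (expCoeff α β (l + 1))) * (l + 1) * groupLaw α β ^ l) * this
  induction L with
  | zero =>
    rw [sum_range_succ, map_add, mul_add, key]
    simp [expCoeff]
  | succ L ih =>
    rw [sum_range_succ, map_add, mul_add, ih, key, sum_range_succ _ (L + 1)]
    have := congrArg (fun x => C (C x)) (expCoeff_rec α β L)
    push_cast
    simp only [map_mul, map_add, map_natCast, map_one, map_ofNat] at this ⊢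
    linear_combination groupLaw α β ^ (L + 1) * this

/-- As series in `x`, `H(F(x, y))` and `H(x) H(y)` satisfy the same first-order linear equation and
agree at `x = 0`, since `F(0, y) = y`. The equation determines the coefficients recursively, whence
the induction on `a`. -/
theorem coeff_partialExp [CharZero K] (α β : K) (L a b : ℕ) (h : a + b ≤ L + 1) :
    coeff b (coeff a (∑ l ∈ range (L + 2), C (C (expCoeff α β l)) * groupLaw α β ^ l)) =
      expCoeff α β a * expCoeff α β b := by
  set T := ∑ l ∈ range (L + 2), C (C (expCoeff α β l)) * groupLaw α β ^ l with hT
  have hD : ∀ a b, a + b < L + 1 →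
      coeff b (coeff a ((1 + C (C α) * PowerSeries.X + C (C β) * PowerSeries.X ^ 2) * d⁄dX _ T)) =
        coeff b (coeff a T) := by
    intro a b hab
    rw [hT, derivative_partialExp, sum_range_succ _ (L + 1)]
    rw [map_add, map_add, map_add, map_add, coeff_C_mul, coeff_C_mul, coeff_C_mul, coeff_C_mul,
      map_add (coeff a), map_add (coeff b), coeff_C_mul, coeff_C_mul]
    rw [coeff_groupLaw_pow_eq_zero _ _ hab,
      coeff_groupLaw_pow_eq_zero _ _ (by omega : a + b < L + 2)]
    simp
  have e : ∀ G : PowerSeries (PowerSeries K),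
      (1 + C (C α) * PowerSeries.X + C (C β) * PowerSeries.X ^ 2) * G =
      G + C (C α) * (PowerSeries.X * G) + C (C β) * (PowerSeries.X * (PowerSeries.X * G)) :=
    fun G => by ring
  induction a using Nat.strong_induction_on with
  | _ a ih =>
    rcases a with _ | _ | a
    · have h0 : constantCoeff (groupLaw α β) = PowerSeries.X := by
        rw [← coeff_zero_eq_constantCoeff_apply, groupLaw, coeff_mk]
        ext j
        rcases j with _ | j
        · simp
        · simp [blockWeight_zero_succ, coeff_X]
      rw [hT, coeff_zero_eq_constantCoeff_apply, map_sum, map_sum]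
      simp only [map_mul, map_pow, h0, constantCoeff_C, coeff_C_mul, coeff_X_pow, mul_ite, mul_one,
        mul_zero]
      rw [sum_ite_eq, if_pos (by rw [mem_range]; omega)]
      simp [expCoeff]
    · have := hD 0 b (by omega)
      rw [e] at this
      simp only [map_add, coeff_C_mul, coeff_zero_X_mul, coeff_derivative, mul_zero,
        add_zero] at this
      rw [ih 0 (by omega) (by omega)] at this
      simpa [expCoeff] using this
    · have := hD (a + 1) b (by omega)
      rw [e] at this
      simp only [map_add, coeff_C_mul, coeff_succ_X_mul] at this
      -- The Euler operator `x d/dx` multiplies the coefficient of `x ^ a` by `a`, including `a =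
      -- 0`.
      have e2 : coeff a (PowerSeries.X * (d⁄dX _) T) = a * coeff a T := by
        rcases a with _ | a
        · simp
        · rw [coeff_succ_X_mul, coeff_derivative]
          push_cast
          ring
      have e3 : ∀ (n : ℕ) (G : PowerSeries K), coeff b ((n : PowerSeries K) * G) = n * coeff b G :=
          fun n G => by
        rw [← map_natCast (C (R := K)), coeff_C_mul]
      have e4 : ∀ (n : ℕ), coeff b (coeff n ((d⁄dX _) T)) = (n + 1) * coeff b (coeff (n + 1) T) :=
          fun n => by
        rw [coeff_derivative, mul_comm]
        exact_mod_cast e3 (n + 1) _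
      rw [e2, e3, e4, e4, ih (a + 1) (by omega) (by omega), ih a (by omega) (by omega)] at this
      have h2 := expCoeff_rec α β a
      have h3 : (a + 2 : K) ≠ 0 := by exact_mod_cast (Nat.succ_ne_zero (a + 1))
      refine mul_left_cancel₀ h3 ?_
      push_cast at this
      linear_combination this - expCoeff α β b * h2

/-- A word of length `l` in `U ⋆ V` arises from `l` successive pairs of blocks, each weighted by a
coefficient of `F`. The total weight of such words is thus a coefficient of `F ^ l`, and no `l`
beyond `|U| + |V|` contributes. -/
theorem shuffleEval_length {A : Type*} [AddCommMonoid A] (α β : K) (U V : List A) (h : ℕ → K)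
    (L : ℕ) (hL : U.length + V.length < L) :
    shuffleEval α β U V (fun P => h P.length) =
      ∑ l ∈ range L, h l * coeff V.length (coeff U.length (groupLaw α β ^ l)) := by
  induction L generalizing U V h with
  | zero => omega
  | succ L ih =>
    classical
    -- Removing the first pair of blocks corresponds to removing one factor `F`; the term `l = 0` is
    -- the empty word.
    rw [shuffleEval_eq, sum_range_succ', add_comm]
    congr 1
    · have : ∀ U₁ U₂ : List A, U₁ ++ U₂ = U → ∀ V₁ V₂ : List A, V₁ ++ V₂ = V →
          blockWeight α β U₁.length V₁.length *
            shuffleEval α β U₂ V₂ (fun P => h ((U₁.sum + V₁.sum) :: P).length) =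
          blockWeight α β U₁.length V₁.length * ∑ l ∈ range L, h (l + 1) *
            coeff V₂.length (coeff U₂.length (groupLaw α β ^ l)) := by
        intro U₁ U₂ hU V₁ V₂ hV
        by_cases h0 : U₁.length = 0 ∧ V₁.length = 0
        · rw [h0.1, h0.2, blockWeight_zero_zero, zero_mul, zero_mul]
        · rw [← ih U₂ V₂ (fun l => h (l + 1))]
          · rfl
          · subst hU hV
            simp only [List.length_append] at hL
            omega
      rw [splitSum_congr fun U₁ U₂ hU => splitSum_congr fun V₁ V₂ hV => this U₁ U₂ hU V₁ V₂ hV]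
      rw [splitSum_congr fun U₁ U₂ _ => splitSum_antidiagonal V fun i j =>
        blockWeight α β U₁.length i * ∑ l ∈ range L, h (l + 1) *
            coeff j (coeff U₂.length (groupLaw α β ^ l))]
      rw [splitSum_antidiagonal U fun i' j' => ∑ p ∈ antidiagonal V.length,
        blockWeight α β i' p.1 * ∑ l ∈ range L, h (l + 1) *
            coeff p.2 (coeff j' (groupLaw α β ^ l))]
      simp only [coeff_groupLaw_pow_succ, mul_sum]
      refine Eq.symm (sum_comm.trans (sum_congr rfl fun p _ => ?_))
      rw [sum_comm]
      refine sum_congr rfl fun q _ => sum_congr rfl fun l _ => ?_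
      ring
    · rcases U with _ | ⟨a, U⟩
      · rcases V with _ | ⟨b, V⟩ <;> simp [coeff_one]
      · simp [coeff_one]

/-- The left side is a coefficient of `H(F(x, y)) = H(x) H(y)`, so `P ↦ h_{|P|}` is a character of
the quasi-shuffle. -/
theorem shuffleEval_expCoeff [CharZero K] {A : Type*} [AddCommMonoid A] (α β : K) (U V : List A) :
    shuffleEval α β U V (fun P => expCoeff α β P.length) =
      expCoeff α β U.length * expCoeff α β V.length := by
  rw [shuffleEval_length α β U V _ (U.length + V.length + 2) (by omega),
    ← coeff_partialExp α β (U.length + V.length) _ _ (by omega)]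
  simp only [map_sum, coeff_C_mul]

end groupLaw

/-! ### Substitution into a scalar series -/

section substNC

open PowerSeries

variable {K A : Type*} [Field K] [Ring A] [Algebra K A]

theorem coeff_pow_eq_zero_of_lt {g : PowerSeries A} (hg : coeff 0 g = 0) {n k : ℕ} (h : n < k) :
    coeff n (g ^ k) = 0 := by
  induction k generalizing n with
  | zero => omega
  | succ k ih =>
    rw [pow_succ', coeff_mul]
    refine sum_eq_zero fun p hp => ?_
    rw [HasAntidiagonal.mem_antidiagonal] at hp
    rcases Nat.eq_zero_or_pos p.1 with h0 | h0
    · rw [h0, hg, zero_mul]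
    · rw [ih (by omega), mul_zero]

theorem coeff_substNC (p : PowerSeries K) {g : PowerSeries A} (hg : coeff 0 g = 0) {n N : ℕ}
    (h : n < N) : coeff n (substNC p g) = ∑ k ∈ range N, coeff k p • coeff n (g ^ k) := by
  rw [substNC, coeff_mk]
  refine sum_subset (fun k hk => ?_) fun k _ hk => ?_
  · rw [mem_range] at hk ⊢
    omega
  · rw [mem_range] at hk
    rw [coeff_pow_eq_zero_of_lt hg (by omega), smul_zero]

theorem substNC_add (p q : PowerSeries K) (g : PowerSeries A) :
    substNC (p + q) g = substNC p g + substNC q g := by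
  ext n
  simp only [substNC, coeff_mk, map_add, add_smul, sum_add_distrib]

theorem substNC_C_mul (r : K) (q : PowerSeries K) (g : PowerSeries A) :
    substNC (C r * q) g = r • substNC q g := by
  ext n
  simp only [substNC, coeff_mk, coeff_C_mul, mul_smul, ← smul_sum, coeff_smul]

theorem substNC_one (g : PowerSeries A) : substNC (1 : PowerSeries K) g = 1 := by
  ext n
  rw [substNC, coeff_mk, sum_range_succ', sum_eq_zero]
  · simp
  · intro k _
    rw [coeff_one, if_neg (Nat.succ_ne_zero k), zero_smul]

theorem substNC_X {g : PowerSeries A} (hg : coeff 0 g = 0) :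
    substNC (PowerSeries.X : PowerSeries K) g = g := by
  ext n
  rw [coeff_substNC _ hg (by omega : n < n + 2), sum_eq_single 1]
  · simp
  · intro k _ hk
    rw [coeff_X, if_neg hk, zero_smul]
  · simp

theorem coeff_zero_substNC {p : PowerSeries K} (hp : coeff 0 p = 0) (g : PowerSeries A) :
    coeff 0 (substNC p g) = 0 := by
  simp [substNC, -coeff_zero_eq_constantCoeff, hp]

/-- Only powers of the one series `g` and scalars are involved, so noncommutativity of `A` does not
interfere. -/
theorem substNC_mul (p q : PowerSeries K) {g : PowerSeries A} (hg : coeff 0 g = 0) :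
    substNC (p * q) g = substNC p g * substNC q g := by
  ext n
  have h1 : coeff n (substNC p g * substNC q g) =
      ∑ i ∈ range (n + 1), ∑ j ∈ range (n + 1),
        (coeff i p * coeff j q) • coeff n (g ^ (i + j)) := by
    rw [coeff_mul]
    have : ∀ x ∈ antidiagonal n, coeff x.1 (substNC p g) * coeff x.2 (substNC q g) =
        ∑ i ∈ range (n + 1), ∑ j ∈ range (n + 1), (coeff i p * coeff j q) •
          (coeff x.1 (g ^ i) * coeff x.2 (g ^ j)) := by
      intro x hx
      rw [HasAntidiagonal.mem_antidiagonal] at hx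
      rw [coeff_substNC p hg (by omega : x.1 < n + 1), coeff_substNC q hg (by omega : x.2 < n + 1),
        sum_mul_sum]
      exact sum_congr rfl fun i _ => sum_congr rfl fun j _ => smul_mul_smul_comm _ _ _ _
    rw [sum_congr rfl this, sum_comm]
    refine sum_congr rfl fun i _ => ?_
    rw [sum_comm]
    refine sum_congr rfl fun j _ => ?_
    rw [← smul_sum, pow_add, coeff_mul]
  rw [h1, substNC, coeff_mk]
  simp only [coeff_mul, sum_smul]
  -- The pairs with `i + j > n` drop out, since `g ^ (i + j)` has no term of degree `n`.
  rw [← sum_product', ← sum_filter_add_sum_filter_not (range (n + 1) ×ˢ range (n + 1))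
    (fun x => x.1 + x.2 < n + 1)]
  rw [sum_eq_zero (s := filter (fun x : ℕ × ℕ => ¬x.1 + x.2 < n + 1) _), add_zero, sum_sigma']
  · refine sum_nbij' (fun x => x.2) (fun x => ⟨x.1 + x.2, x⟩) ?_ ?_ ?_ ?_ ?_
    · rintro ⟨k, x⟩ h
      simp only [mem_sigma, mem_range, HasAntidiagonal.mem_antidiagonal, mem_filter,
        mem_product] at h ⊢
      omega
    · rintro x h
      simp only [mem_sigma, mem_range, HasAntidiagonal.mem_antidiagonal, mem_filter,
        mem_product] at h ⊢
      exact ⟨h.2, trivial⟩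
    · rintro ⟨k, x⟩ h
      simp only [mem_sigma, HasAntidiagonal.mem_antidiagonal] at h
      obtain ⟨-, rfl⟩ := h
      rfl
    · intro x _
      rfl
    · rintro ⟨k, x⟩ h
      simp only [mem_sigma, HasAntidiagonal.mem_antidiagonal] at h
      rw [h.2]
  · intro x hx
    rw [mem_filter] at hx
    rw [coeff_pow_eq_zero_of_lt hg (by omega), smul_zero]

theorem substNC_pow (p : PowerSeries K) {g : PowerSeries A} (hg : coeff 0 g = 0) (k : ℕ) :
    substNC (p ^ k) g = substNC p g ^ k := by
  induction k with
  | zero => rw [pow_zero, pow_zero, substNC_one]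
  | succ k ih => rw [pow_succ, pow_succ, substNC_mul _ _ hg, ih]

theorem substNC_substNC (p : PowerSeries K) {q : PowerSeries K} (hq : coeff 0 q = 0)
    {g : PowerSeries A} (hg : coeff 0 g = 0) :
    substNC p (substNC q g) = substNC (substNC p q) g := by
  ext n
  rw [coeff_substNC _ (coeff_zero_substNC hq g) n.lt_succ_self, coeff_substNC _ hg n.lt_succ_self]
  have h1 : ∀ k ∈ range (n + 1), coeff k (substNC p q) • coeff n (g ^ k) =
      ∑ i ∈ range (n + 1), (coeff i p * coeff k (q ^ i)) • coeff n (g ^ k) := by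
    intro k hk
    rw [coeff_substNC p hq (mem_range.1 hk), sum_smul]
    rfl
  rw [sum_congr rfl h1, sum_comm]
  refine sum_congr rfl fun i _ => ?_
  rw [← substNC_pow _ hg, coeff_substNC _ hg n.lt_succ_self, smul_sum]
  exact sum_congr rfl fun k _ => smul_smul _ _ _

theorem derivative_substNC (p : PowerSeries K) {g : PowerSeries K} (hg : coeff 0 g = 0) :
    d⁄dX K (substNC p g) = substNC (d⁄dX K p) g * d⁄dX K g := by
  ext n
  rw [coeff_derivative, coeff_substNC p hg (by omega : n + 1 < n + 2), coeff_mul]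
  have h1 : ∀ x ∈ antidiagonal n, coeff x.1 (substNC (d⁄dX K p) g) * coeff x.2 (d⁄dX K g) =
      ∑ k ∈ range (n + 1), coeff (k + 1) p * (k + 1) *
        (coeff x.1 (g ^ k) * coeff x.2 (d⁄dX K g)) := by
    intro x hx
    rw [HasAntidiagonal.mem_antidiagonal] at hx
    rw [coeff_substNC _ hg (by omega : x.1 < n + 1), sum_mul]
    refine sum_congr rfl fun k _ => ?_
    rw [coeff_derivative p, smul_eq_mul, mul_assoc]
  rw [sum_congr rfl h1, sum_comm, sum_range_succ', add_mul, sum_mul]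
  have h2 : coeff (n + 1) (g ^ 0) = 0 := by
    rw [pow_zero, coeff_one, if_neg (Nat.succ_ne_zero n)]
  rw [h2, smul_zero, zero_mul, add_zero]
  refine sum_congr rfl fun k _ => ?_
  rw [← mul_sum, ← coeff_mul, smul_eq_mul, mul_assoc, ← Nat.cast_succ n, Nat.cast_succ,
    ← coeff_derivative, derivative_pow, Nat.add_sub_cancel, mul_assoc, mul_assoc,
    ← map_natCast (C (R := K)), coeff_C_mul]
  push_cast
  ring

end substNC

/-! ### The compositional inverse of `f ∘ log` -/

theorem coeff_zero_logSeries {K : Type*} [Field K] : PowerSeries.coeff 0 (logSeries K) = 0 := by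
  rw [logSeries, PowerSeries.coeff_mk, if_pos rfl]

section series

open PowerSeries

variable {K : Type*} [Field K] [CharZero K] (s t : K)

/-- Together with `derivative_fDen`, this is a linear system for numerator and denominator that is
valid also for `s = t`; it yields the equation of `f` by the quotient rule. -/
theorem derivative_fNum :
    d⁄dX K (fNum s t) = fDen s t + C (s + t) * fNum s t := by
  ext n
  have h0 : ((n + 1 : ℕ) : K) ≠ 0 := Nat.cast_ne_zero.2 n.succ_ne_zero
  have h1 : (n.factorial : K) ≠ 0 := Nat.cast_ne_zero.2 n.factorial_ne_zero
  have h2 : ∑ i ∈ range (n + 1), s ^ i * t ^ (n + 1 - 1 - i) =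
      t ^ n + s * ∑ i ∈ range n, s ^ i * t ^ (n - 1 - i) := by
    rw [sum_range_succ', add_comm, mul_sum]
    congr 1
    · simp
    · refine sum_congr rfl fun i _ => ?_
      rw [pow_succ', show n + 1 - 1 - (i + 1) = n - 1 - i by omega, mul_assoc]
  rw [coeff_derivative, fDen, map_add, map_sub, coeff_C_mul, coeff_C_mul]
  simp only [fNum, coeff_mk]
  rw [h2, Nat.factorial_succ]
  push_cast at h0 ⊢
  field_simp
  ring

theorem derivative_fDen : d⁄dX K (fDen s t) = -(C (s * t) * fNum s t) := by
  have h1 : d⁄dX K (PowerSeries.mk fun n => t ^ n / (n.factorial : K)) =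
      C t * PowerSeries.mk fun n => t ^ n / (n.factorial : K) := by
    ext n
    have h0 : ((n + 1 : ℕ) : K) ≠ 0 := Nat.cast_ne_zero.2 n.succ_ne_zero
    have h1 : (n.factorial : K) ≠ 0 := Nat.cast_ne_zero.2 n.factorial_ne_zero
    rw [coeff_derivative, coeff_C_mul, coeff_mk, coeff_mk, Nat.factorial_succ]
    push_cast at h0 ⊢
    field_simp
    ring
  have h2 : (PowerSeries.mk fun n => t ^ n / (n.factorial : K)) =
      fDen s t + C t * fNum s t := by
    rw [fDen]; ring
  rw [h2] at h1
  rw [map_add] at h1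
  simp only [Derivation.leibniz, derivative_C, smul_eq_mul, mul_zero, add_zero,
    derivative_fNum] at h1
  simp only [map_add, map_mul] at h1 ⊢
  linear_combination h1

theorem constantCoeff_fDen : constantCoeff (fDen s t) = 1 := by
  rw [fDen, map_sub, map_mul, ← PowerSeries.coeff_zero_eq_constantCoeff_apply,
    ← PowerSeries.coeff_zero_eq_constantCoeff_apply (φ := fNum s t)]
  simp [fNum]

theorem coeff_zero_fSeries {K : Type*} [Field K] (s t : K) : coeff 0 (fSeries s t) = 0 := by
  rw [fSeries, coeff_zero_eq_constantCoeff_apply, map_mul,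
    ← coeff_zero_eq_constantCoeff_apply (φ := fNum s t), fNum, coeff_mk]
  simp

theorem derivative_fSeries :
    d⁄dX K (fSeries s t) = 1 + C (s + t) * fSeries s t + C (s * t) * fSeries s t ^ 2 := by
  have h0 : constantCoeff (fDen s t) ≠ 0 := by
    rw [constantCoeff_fDen]
    exact one_ne_zero
  have h1 : fSeries s t * fDen s t = fNum s t := by
    rw [fSeries, mul_assoc, PowerSeries.inv_mul_cancel _ h0, mul_one]
  have h2 := congrArg (d⁄dX K) h1
  simp only [Derivation.leibniz, smul_eq_mul, derivative_fNum, derivative_fDen] at h2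
  have h3 : fDen s t ≠ 0 := fun h => h0 (by rw [h, map_zero])
  refine mul_right_cancel₀ h3 ?_
  linear_combination h2 - (C (s + t) + C (s * t) * fSeries s t) * h1

theorem derivative_expCoeff (α β : K) :
    d⁄dX K (.mk (expCoeff α β)) * (1 + C α * PowerSeries.X + C β * PowerSeries.X ^ 2) =
      .mk (expCoeff α β) := by
  have e : ∀ G : PowerSeries K, G * (1 + C α * PowerSeries.X + C β * PowerSeries.X ^ 2) =
      G + C α * (PowerSeries.X * G) + C β * (PowerSeries.X * (PowerSeries.X * G)) :=
    fun G => by ring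
  ext n
  rw [e]
  rcases n with _ | _ | n
  · simp only [map_add, coeff_C_mul, coeff_zero_X_mul, coeff_derivative, coeff_mk]
    simp [expCoeff]
  · simp only [map_add, coeff_C_mul, coeff_succ_X_mul, coeff_zero_X_mul, coeff_derivative, coeff_mk]
    have := expCoeff_rec α β 0
    push_cast at this ⊢
    linear_combination this
  · simp only [map_add, coeff_C_mul, coeff_succ_X_mul, coeff_derivative, coeff_mk]
    have := expCoeff_rec α β (n + 1)
    push_cast at this ⊢
    linear_combination this

theorem derivative_logSeries : (1 + PowerSeries.X) * d⁄dX K (logSeries K) = 1 := by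
  ext n
  have h : ∀ n, coeff n (d⁄dX K (logSeries K)) = (-1) ^ n := by
    intro n
    have h0 : (n + 1 : K) ≠ 0 := Nat.cast_add_one_ne_zero n
    rw [coeff_derivative, logSeries, coeff_mk, if_neg n.succ_ne_zero, Nat.add_sub_cancel,
      Nat.cast_succ, div_mul_cancel₀ _ h0]
  rw [add_mul, one_mul, map_add, h]
  rcases n with _ | n
  · simp
  · rw [coeff_succ_X_mul, h, coeff_one, if_neg n.succ_ne_zero]
    ring

/-- The equations of `H` and `f` give `G' = G` for `G = H ∘ f`. Then `Z = G ∘ log (1 + x)` satisfies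
`(1 + x) Z' = Z` and `Z(0) = 1`, which forces `Z = 1 + x`. -/
theorem substNC_expCoeff_fSeries_logSeries :
    substNC (substNC (.mk (expCoeff (s + t) (s * t))) (fSeries s t)) (logSeries K) =
      1 + PowerSeries.X := by
  have hf := coeff_zero_fSeries s t
  have hl := coeff_zero_logSeries (K := K)
  have h1 : d⁄dX K (substNC (.mk (expCoeff (s + t) (s * t))) (fSeries s t)) =
      substNC (.mk (expCoeff (s + t) (s * t))) (fSeries s t) := by
    rw [derivative_substNC _ hf, derivative_fSeries]
    conv_rhs => rw [← derivative_expCoeff, substNC_mul _ _ hf, substNC_add, substNC_add,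
      substNC_one, substNC_C_mul, substNC_C_mul, substNC_pow _ hf, substNC_X hf]
    rw [smul_eq_C_mul, smul_eq_C_mul]
  set G := substNC (.mk (expCoeff (s + t) (s * t))) (fSeries s t) with hG
  have h2 : (1 + PowerSeries.X) * d⁄dX K (substNC G (logSeries K)) = substNC G (logSeries K) := by
    rw [derivative_substNC _ hl, h1, mul_left_comm, derivative_logSeries, mul_one]
  have h3 : coeff 0 (substNC G (logSeries K)) = 1 := by
    rw [substNC, coeff_mk, hG, sum_range_one, substNC, coeff_mk, sum_range_one]
    simp [expCoeff]
  set Z := substNC G (logSeries K)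
  have h4 : ∀ n, coeff (n + 1) Z * (n + 1) + n * coeff n Z = coeff n Z := by
    intro n
    have := congrArg (coeff n) h2
    rw [add_mul, one_mul, map_add, coeff_derivative] at this
    rcases n with _ | n
    · rw [coeff_zero_X_mul] at this
      simpa [-coeff_zero_eq_constantCoeff] using this
    · rw [coeff_succ_X_mul, coeff_derivative] at this
      push_cast at this ⊢
      linear_combination this
  have h5 : coeff 1 Z = 1 := by
    have := h4 0
    rw [h3] at this
    simpa using this
  -- In `h4` the case `n = 1` reads `2 z_2 + z_1 = z_1`; from there on vanishing propagates.
  have h6 : ∀ n, coeff (n + 2) Z = 0 := by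
    intro n
    induction n with
    | zero =>
      have := h4 1
      rw [h5] at this
      norm_num at this
      exact this
    | succ n ih =>
      have := h4 (n + 2)
      rw [ih] at this
      simp only [mul_zero, add_zero, mul_eq_zero] at this
      exact this.resolve_right (Nat.cast_add_one_ne_zero (n + 2))
  ext n
  rcases n with _ | _ | n
  · rw [h3]; simp
  · rw [zero_add, h5]; simp [coeff_one]
  · rw [h6]; simp [coeff_one, coeff_X]

theorem substNC_expCoeff_Y :
    substNC (.mk (expCoeff (s + t) (s * t))) (.mk (Y s t)) = PowerSeries.mk (S K) := by
  have hg : coeff 0 ((PowerSeries.mk fun n => S K n) - 1) = 0 := by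
    simp [S, -coeff_zero_eq_constantCoeff]
  have hf := coeff_zero_fSeries s t
  have hl := coeff_zero_logSeries (K := K)
  have e : PowerSeries.mk (Y s t) = substNC (fSeries s t) (phiSeries K) := by
    ext n
    rw [coeff_mk, Y]
  rw [e, phiSeries, substNC_substNC _ hf (coeff_zero_substNC hl _), substNC_substNC _ hl hg,
    substNC_expCoeff_fSeries_logSeries, substNC_add, substNC_one, substNC_X hg]
  exact add_sub_cancel _ _

theorem Y_zero {K : Type*} [Field K] (s t : K) : Y s t 0 = 0 :=
  coeff_zero_substNC (coeff_zero_fSeries s t) _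

end series

/-! ### Linear independence from spanning, in families with finite fibers -/

/-- In degrees below `N` both families are finite with the same index set. The span of `x` contains
the independent family `b`, so its dimension is the number of vectors of `x`. -/
theorem linearIndependent_of_mem_span {K E : Type*} [Field K] [AddCommGroup E] [Module K E]
    {ι : ℕ → Type*} [∀ n, Finite (ι n)] {b x : (Σ n, ι n) → E} (hb : LinearIndependent K b)
    (h : ∀ n i, b ⟨n, i⟩ ∈ Submodule.span K (Set.range fun j => x ⟨n, j⟩)) :
    LinearIndependent K x := by
  classical
  have := fun n => Fintype.ofFinite (ι n)
  have key : ∀ N : ℕ, LinearIndependent K fun i : (Σ n : Fin N, ι n) => x ⟨i.1, i.2⟩ := by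
    intro N
    have hb' : LinearIndependent K fun i : (Σ n : Fin N, ι n) => b ⟨i.1, i.2⟩ := by
      refine hb.comp (fun i : (Σ n : Fin N, ι n) => (⟨i.1, i.2⟩ : Σ n, ι n)) ?_
      rintro ⟨⟨n, hn⟩, i⟩ ⟨⟨m, hm⟩, j⟩ h
      simp only [Sigma.mk.injEq] at h
      obtain ⟨rfl, h⟩ := h
      rw [eq_of_heq h]
    rw [linearIndependent_iff_card_le_finrank_span, ← finrank_span_eq_card hb']
    have : FiniteDimensional K
        (Submodule.span K (Set.range fun i : (Σ n : Fin N, ι n) => x ⟨i.1, i.2⟩)) :=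
      FiniteDimensional.span_of_finite K (Set.finite_range _)
    refine Submodule.finrank_mono ?_
    rw [Submodule.span_le]
    rintro _ ⟨⟨n, i⟩, rfl⟩
    refine Submodule.span_mono ?_ (h n i)
    rintro _ ⟨j, rfl⟩
    exact ⟨⟨n, j⟩, rfl⟩
  rw [linearIndependent_iff_finset_linearIndependent]
  intro u
  refine (key (u.sup Sigma.fst + 1)).comp
    (fun i : u => ⟨⟨i.1.1, Nat.lt_succ_of_le (le_sup (f := Sigma.fst) i.2)⟩, i.1.2⟩) ?_
  rintro ⟨⟨n, i⟩, hi⟩ ⟨⟨m, j⟩, hj⟩ h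
  simp only [Sigma.mk.injEq, Fin.mk.injEq] at h
  obtain ⟨rfl, h⟩ := h
  obtain rfl := eq_of_heq h
  rfl

/-! ### Contractions of words with positive letters -/

theorem splitSum_eq_single {A N : Type*} [AddCommMonoid N] (U₁ U₂ : List A)
    (g : List A → List A → N)
    (h : ∀ x y, x ++ y = U₁ ++ U₂ → x.length ≠ U₁.length → g x y = 0) :
    splitSum (U₁ ++ U₂) g = g U₁ U₂ := by
  induction U₁ generalizing g with
  | nil =>
    refine (splitSum_congr (g' := fun x y => if x = [] then g x y else 0) ?_).trans ?_
    · intro x y e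
      split_ifs with hx
      · rfl
      · exact h x y e (by simpa using hx)
    · rw [splitSum_eq_first]
      · simp
      · simp
  | cons a U₁ ih =>
    rw [List.cons_append, splitSum_cons, h [] (a :: (U₁ ++ U₂)) rfl (by simp), zero_add,
      ih (fun x y => g (a :: x) y)]
    intro x y e hx
    exact h (a :: x) y (by rw [List.cons_append, e, List.cons_append]) (by simpa using hx)

section contract

variable {R A : Type*} [CommSemiring R] [AddCommMonoid A]

/-- Letters of positive degree make the prefix sums strictly increase in degree, so only one prefix
has the sum of `U₁`. -/
theorem contract_append (h : ℕ → R) (δ : A →+ ℕ) {U₁ U₂ : List A}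
    (hU : ∀ a ∈ U₁ ++ U₂, 0 < δ a) (W : List A) :
    contract h (U₁ ++ U₂) (U₁.sum :: W) = h U₁.length * contract h U₂ W := by
  rw [contract, splitSum_eq_single, if_pos rfl]
  intro x y e hx
  refine if_neg fun hs => hx ?_
  have hpos : ∀ c : List A, (∀ a ∈ c, 0 < δ a) → δ c.sum = 0 → c = [] := by
    rintro (_ | ⟨a, c⟩) hc h0
    · rfl
    · rw [List.sum_cons, map_add] at h0
      have := hc a (by simp)
      omega
  rcases List.append_eq_append_iff.1 e with ⟨c, h1, h2⟩ | ⟨c, h1, h2⟩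
  · rw [hpos c (fun a ha => hU a (by simp [h1, ha])) ?_] at h1
    · rw [h1, List.append_nil]
    · rw [h1, List.sum_append] at hs
      have := congrArg δ hs
      rw [map_add] at this
      omega
  · rw [hpos c (fun a ha => hU a (by simp [h2, ha])) ?_] at h1
    · rw [h1, List.append_nil]
    · rw [h1, List.sum_append] at hs
      have := congrArg δ hs
      rw [map_add] at this
      omega

theorem contract_self {h : ℕ → R} (h1 : h 1 = 1) (δ : A →+ ℕ) {U : List A}
    (hU : ∀ a ∈ U, 0 < δ a) : contract h U U = 1 := by
  induction U with
  | nil => simp [contract]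
  | cons a U ih =>
    have := contract_append h δ (U₁ := [a]) (U₂ := U) hU U
    rw [List.sum_singleton, List.singleton_append, List.length_singleton, h1, one_mul] at this
    rw [this, ih fun b hb => hU b (by simp [hb])]

theorem exists_of_contract_ne_zero {h : ℕ → R} {P W : List A} {q : A}
    (hne : contract h P (q :: W) ≠ 0) :
    ∃ P₁ P₂, P = P₁ ++ P₂ ∧ P₁.sum = q ∧ contract h P₂ W ≠ 0 := by
  by_contra! hc
  refine hne ?_
  rw [contract]
  refine splitSum_eq_zero fun P₁ P₂ e => ?_
  split_ifs with h1
  · rw [hc P₁ P₂ e.symm h1, mul_zero]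
  · rfl

/-- A contraction can be computed after taking degrees, once it is possible. -/
theorem contract_map {h' : ℕ → R} (h : ℕ → R) (δ : A →+ ℕ) {P W : List A} (hP : ∀ a ∈ P, 0 < δ a)
    (hne : contract h' P W ≠ 0) : contract h (P.map δ) (W.map δ) = contract h P W := by
  induction W generalizing P with
  | nil => simp [contract]
  | cons q W ih =>
    -- Nonvanishing supplies a block with the right sum; positivity makes it the only candidate both
    -- before and after taking degrees.
    obtain ⟨P₁, P₂, rfl, rfl, h2⟩ := exists_of_contract_ne_zero hne
    rw [contract_append h δ hP, List.map_append, List.map_cons, map_list_sum,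
      contract_append h (AddMonoidHom.id ℕ), List.length_map,
      ih (fun a ha => hP a (by simp [ha])) h2]
    intro a ha
    rw [← List.map_append, List.mem_map] at ha
    obtain ⟨b, hb, rfl⟩ := ha
    exact hP b hb

end contract

/-! ### Expansion of the complete functions on products of the `Y_n` -/

/-- The compositions of `n`, as lists. -/
def compLists (n : ℕ) : Finset (List ℕ) :=
  (univ : Finset (Composition n)).map ⟨Composition.blocks, fun _ _ h => Composition.ext h⟩

theorem mem_compLists {n : ℕ} {l : List ℕ} :
    l ∈ compLists n ↔ (∀ a ∈ l, 0 < a) ∧ l.sum = n := by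
  simp only [compLists, mem_map, mem_univ, true_and]
  constructor
  · rintro ⟨I, rfl⟩
    exact ⟨fun a ha => I.blocks_pos ha, I.blocks_sum⟩
  · rintro ⟨h1, h2⟩
    exact ⟨⟨l, fun {a} ha => h1 a ha, h2⟩, rfl⟩

theorem sum_compLists {N : Type*} [AddCommMonoid N] (n : ℕ) (F : List ℕ → N) :
    ∑ l ∈ compLists n, F l = ∑ I : Composition n, F I.blocks := by
  rw [compLists, sum_map]
  rfl

theorem length_le_sum {l : List ℕ} (h : ∀ a ∈ l, 0 < a) : l.length ≤ l.sum := by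
  induction l with
  | nil => simp
  | cons a l ih =>
    have h1 := h a (by simp)
    have h2 := ih fun b hb => h b (by simp [hb])
    simp only [List.length_cons, List.sum_cons]
    omega

theorem coeff_pow_eq_sum_compLists {A : Type*} [Ring A] {y : ℕ → A} (hy : y 0 = 0) (n k : ℕ) :
    PowerSeries.coeff n (PowerSeries.mk y ^ k) =
      ∑ l ∈ compLists n with l.length = k, (l.map y).prod := by
  induction k generalizing n with
  | zero =>
    rw [pow_zero, PowerSeries.coeff_one]
    split_ifs with h
    · subst h
      rw [sum_eq_single_of_mem []]
      · simp
      · simp [mem_compLists]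
      · intro l hl h0
        exact absurd (List.length_eq_zero_iff.1 (mem_filter.1 hl).2) h0
    · refine (sum_eq_zero fun l hl => ?_).symm
      rw [mem_filter, mem_compLists, List.length_eq_zero_iff] at hl
      obtain ⟨⟨-, h1⟩, rfl⟩ := hl
      exact absurd h1.symm h
  | succ k ih =>
    rw [pow_succ', PowerSeries.coeff_mul]
    simp only [ih, PowerSeries.coeff_mk, mul_sum]
    rw [sum_sigma']
    symm
    -- The head is split off; the default `0` is never used, as the lists have length `k + 1`.
    -- Nonvanishing discards the head `0`, where `y 0 = 0`.
    refine sum_bij_ne_zero (fun l _ _ => ⟨(l.headD 0, l.tail.sum), l.tail⟩) ?_ ?_ ?_ ?_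
    · rintro (_ | ⟨a, l⟩) h -
      · simp at h
      · simp only [mem_filter, mem_compLists, List.mem_cons, forall_eq_or_imp, List.sum_cons,
          List.length_cons, add_left_inj] at h
        simp only [List.headD_cons, List.tail_cons, mem_sigma, mem_filter, mem_compLists,
          HasAntidiagonal.mem_antidiagonal]
        exact ⟨h.1.2, ⟨h.1.1.2, trivial⟩, h.2⟩
    · rintro (_ | ⟨a, l⟩) h - (_ | ⟨a', l'⟩) h' - e
      · rfl
      · simp at h
      · simp at h'
      · simp only [List.headD_cons, List.tail_cons, Sigma.mk.injEq, Prod.mk.injEq,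
          heq_eq_eq] at e
        rw [e.1.1, e.2]
    · rintro ⟨⟨a, m⟩, l⟩ h h0
      simp only [mem_sigma, mem_filter, mem_compLists, HasAntidiagonal.mem_antidiagonal] at h
      obtain ⟨h1, ⟨h2, rfl⟩, rfl⟩ := h
      have ha : 0 < a := by
        rcases Nat.eq_zero_or_pos a with rfl | ha
        · simp [hy] at h0
        · exact ha
      refine ⟨a :: l, ?_, by simpa using h0, rfl⟩
      simp only [mem_filter, mem_compLists, List.mem_cons, forall_eq_or_imp, List.sum_cons,
        List.length_cons, and_true]
      exact ⟨⟨ha, h2⟩, h1⟩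
    · rintro (_ | ⟨a, l⟩) h -
      · simp at h
      · simp

section Y

variable {K : Type*} [Field K] [CharZero K] (s t : K)

theorem S_eq_sum (n : ℕ) : S K n =
    ∑ l ∈ compLists n, expCoeff (s + t) (s * t) l.length • (l.map (Y s t)).prod := by
  have h := congrArg (PowerSeries.coeff n) (substNC_expCoeff_Y s t)
  rw [PowerSeries.coeff_mk] at h
  rw [← h, substNC, PowerSeries.coeff_mk]
  simp only [coeff_pow_eq_sum_compLists (Y_zero s t), PowerSeries.coeff_mk, smul_sum]
  rw [sum_sigma']
  refine sum_nbij' (fun x => x.2) (fun l => ⟨l.length, l⟩) ?_ ?_ ?_ ?_ ?_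
  · rintro ⟨k, l⟩ h
    simp only [mem_sigma, mem_filter] at h
    exact h.2.1
  · intro l hl
    have h1 := mem_compLists.1 hl
    have h2 := length_le_sum h1.1
    simp only [mem_sigma, mem_filter, mem_range]
    exact ⟨by omega, hl, trivial⟩
  · rintro ⟨k, l⟩ h
    simp only [mem_sigma, mem_filter] at h
    rw [h.2.2]
  · intro l _
    rfl
  · rintro ⟨k, l⟩ h
    simp only [mem_sigma, mem_filter] at h
    rw [h.2.2]

/-- The expansions of the factors are multiplied. Concatenating compositions of the parts of `J` is
injective, and its image contains every composition with nonzero contraction along `J`. -/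
theorem prod_S_eq_sum {J : List ℕ} (hJ : ∀ j ∈ J, 0 < j) : (J.map (S K)).prod =
    ∑ l ∈ compLists J.sum, contract (expCoeff (s + t) (s * t)) l J • (l.map (Y s t)).prod := by
  induction J with
  | nil =>
    rw [sum_eq_single_of_mem []]
    · simp [contract]
    · simp [mem_compLists]
    · intro l _ hl
      simp [contract, hl]
  | cons j J ih =>
    rw [List.map_cons, List.prod_cons, ih fun a ha => hJ a (by simp [ha]), S_eq_sum s t j,
      sum_mul_sum, ← sum_product']
    symm
    refine (sum_subset (s₁ := (compLists j ×ˢ compLists J.sum).image fun x => x.1 ++ x.2)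
      ?_ ?_).symm.trans ?_
    · intro l hl
      simp only [mem_image, mem_product, mem_compLists] at hl
      obtain ⟨x, ⟨⟨h1, h2⟩, h3, h4⟩, rfl⟩ := hl
      rw [mem_compLists, List.sum_append, List.sum_cons, h2, h4]
      refine ⟨fun a ha => ?_, rfl⟩
      rcases List.mem_append.1 ha with ha | ha
      · exact h1 a ha
      · exact h3 a ha
    · intro l hl hl'
      rw [mem_compLists, List.sum_cons] at hl
      by_contra hne
      obtain ⟨P₁, P₂, rfl, h2, h3⟩ := exists_of_contract_ne_zero (left_ne_zero_of_smul hne)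
      refine hl' (mem_image.2 ⟨(P₁, P₂), ?_, rfl⟩)
      rw [List.sum_append] at hl
      simp only [mem_product, mem_compLists]
      exact ⟨⟨fun a ha => hl.1 a (by simp [ha]), h2⟩, fun a ha => hl.1 a (by simp [ha]), by omega⟩
    · rw [sum_image]
      · refine sum_congr rfl fun x hx => ?_
        simp only [mem_product, mem_compLists] at hx
        obtain ⟨⟨h1, rfl⟩, h3, -⟩ := hx
        rw [contract_append _ (AddMonoidHom.id ℕ), List.map_append, List.prod_append,
          smul_mul_smul_comm]
        intro a ha
        rcases List.mem_append.1 ha with ha | ha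
        · exact h1 a ha
        · exact h3 a ha
      · intro x hx y hy e
        simp only [coe_product, Set.mem_prod, mem_coe, mem_compLists] at hx hy
        have key : ∀ {x y c : List ℕ}, (∀ a ∈ y, 0 < a) → y = x ++ c → x.sum = y.sum → c = [] := by
          rintro x y (_ | ⟨a, c⟩) h1 rfl h3
          · rfl
          · have := h1 a (by simp)
            simp at h3
            omega
        have e' : x.1 = y.1 := by
          rcases List.append_eq_append_iff.1 e with ⟨c, h1, -⟩ | ⟨c, h1, -⟩
          · rw [h1, key hy.1.1 h1 (by rw [hx.1.2, hy.1.2]), List.append_nil]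
          · rw [h1, key hx.1.1 h1 (by rw [hx.1.2, hy.1.2]), List.append_nil]
        refine Prod.ext e' ?_
        simp only [e'] at e
        exact List.append_cancel_left e

theorem SComp_eq_sum_contract {n : ℕ} (J : Composition n) : SComp K J =
    ∑ I : Composition n, contract (expCoeff (s + t) (s * t)) I.blocks J.blocks • YComp s t I := by
  rw [SComp, prod_S_eq_sum s t fun j hj => J.blocks_pos hj, J.blocks_sum, sum_compLists]
  rfl

theorem SComp_eq_basis {K : Type*} [Field K] {n : ℕ} (J : Composition n) :
    SComp K J = FreeAlgebra.basisFreeMonoid K ℕ+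
      (FreeMonoid.ofList (J.blocks.map Nat.toPNat')) := by
  have h : ∀ l : List ℕ, (∀ a ∈ l, 0 < a) → (l.map (S K)).prod =
      FreeAlgebra.basisFreeMonoid K ℕ+ (FreeMonoid.ofList (l.map Nat.toPNat')) := by
    intro l hl
    have e : ∀ w : FreeMonoid ℕ+, FreeAlgebra.basisFreeMonoid K ℕ+ w =
        FreeMonoid.lift (FreeAlgebra.ι K) w := by
      intro w
      simp [FreeAlgebra.basisFreeMonoid, FreeAlgebra.equivMonoidAlgebraFreeMonoid]
    rw [e, FreeMonoid.lift_apply, FreeMonoid.toList_ofList, List.map_map]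
    congr 1
    refine List.map_congr_left fun a ha => ?_
    rw [S, dif_pos (hl a ha), Function.comp]
    congr 1
    exact PNat.eq (by simpa [Nat.toPNat'] using (Nat.succ_pred_eq_of_pos (hl a ha)).symm)
  exact h _ fun a ha => J.blocks_pos ha

/-- `Nat.toPNat'` identifies `0` and `1`, so positivity of the blocks matters. -/
theorem toPNat'_blocks_injective {n m : ℕ} {I : Composition n} {J : Composition m}
    (h : I.blocks.map Nat.toPNat' = J.blocks.map Nat.toPNat') : I.blocks = J.blocks := by
  have := congrArg (List.map PNat.val) h
  rw [List.map_map, List.map_map] at this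
  have e : ∀ l : List ℕ, (∀ a ∈ l, 0 < a) → l.map (PNat.val ∘ Nat.toPNat') = l := by
    intro l hl
    conv_rhs => rw [← List.map_id l]
    exact List.map_congr_left fun a ha => by
      simpa [Nat.toPNat'] using Nat.succ_pred_eq_of_pos (hl a ha)
  rwa [e _ fun a ha => I.blocks_pos ha, e _ fun a ha => J.blocks_pos ha] at this

theorem linearIndependent_SComp (K : Type*) [Field K] :
    LinearIndependent K (fun I : (Σ n, Composition n) => SComp K I.2) := by
  have h := (FreeAlgebra.basisFreeMonoid K ℕ+).linearIndependent.comp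
    (fun I : (Σ n, Composition n) => FreeMonoid.ofList (I.2.blocks.map Nat.toPNat')) (by
      rintro ⟨n, I⟩ ⟨m, J⟩ h
      have h' := toPNat'_blocks_injective (FreeMonoid.ofList.injective h)
      have : n = m := by rw [← I.blocks_sum, ← J.blocks_sum, h']
      subst this
      exact congrArg _ (Composition.ext h'))
  have e : (fun I : (Σ n, Composition n) => SComp K I.2) = FreeAlgebra.basisFreeMonoid K ℕ+ ∘
      fun I => FreeMonoid.ofList (I.2.blocks.map Nat.toPNat') :=
    funext fun I => SComp_eq_basis I.2
  rw [e]
  exact h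

theorem linearIndependent_YComp :
    LinearIndependent K (fun I : (Σ n, Composition n) => YComp s t I.2) := by
  refine linearIndependent_of_mem_span (linearIndependent_SComp K) fun n J => ?_
  rw [SComp_eq_sum_contract s t J]
  exact Submodule.sum_mem _ fun I _ => Submodule.smul_mem _ _ (Submodule.subset_span ⟨I, rfl⟩)

/-- The coefficients `c_{IJ}` in terms of the expansion of `H`. -/
theorem c_eq_contract {n : ℕ} (I J : Composition n) :
    c s t I J = contract (expCoeff (s + t) (s * t)) I.blocks J.blocks := by
  have h : (yMatrix s t n)⁻¹ = Matrix.of fun J I : Composition n =>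
      contract (expCoeff (s + t) (s * t)) I.blocks J.blocks := by
    -- The product of the two matrices expands `S ^ J` on the `Y ^ I` and then back on the `S ^ J'`.
    refine Matrix.inv_eq_left_inv ?_
    ext J J'
    rw [Matrix.mul_apply, Matrix.one_apply]
    have := congrArg (fun x => (FreeAlgebra.basisFreeMonoid K ℕ+).repr x
      (FreeMonoid.ofList (J'.blocks.map Nat.toPNat'))) (SComp_eq_sum_contract s t J)
    simp only [map_sum, map_smul, Finsupp.coe_finsetSum, Finset.sum_apply, Finsupp.smul_apply,
      smul_eq_mul, SComp_eq_basis, Module.Basis.repr_self] at this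
    refine Eq.trans this.symm ?_
    by_cases hJ : J = J'
    · rw [hJ, if_pos rfl, Finsupp.single_eq_same]
    · rw [if_neg hJ, Finsupp.single_eq_of_ne]
      exact fun h => hJ (Composition.ext
        (toPNat'_blocks_injective (FreeMonoid.ofList.injective h)).symm)
  rw [c, h, Matrix.of_apply]

end Y

/-! ### Rows of packed words -/

/-- The indicator function of the positions of a letter. -/
def rowFn {n : ℕ} (x : Fin n → ℕ) (i : ℕ) : Fin n → ℕ := fun j => if x j = i then 1 else 0

/-- The rows `1, …, r` of a word. -/
def rowList {n : ℕ} (x : Fin n → ℕ) (r : ℕ) : List (Fin n → ℕ) := (List.range' 1 r).map (rowFn x)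

/-- The monotonicity in `u` of the letters `x_j > i`. -/
def MonoAbove {n : ℕ} (u x : Fin n → ℕ) (i : ℕ) : Prop :=
  ∀ j k, u j ≤ u k → i < x j → x j ≤ x k

/-- The letters `k + 1, …, k + a` of `u` are at the positions of the letter `i + 1` of `x`. -/
def IsBlock {n : ℕ} (u x : Fin n → ℕ) (k i a : ℕ) : Prop :=
  ∀ j, (k < u j ∧ u j ≤ k + a) ↔ x j = i + 1

theorem IsBlock.eq_numValues {n : ℕ} {u x : Fin n → ℕ} (hu : IsPacked u) {k i a : ℕ}
    (h : IsBlock u x k i a) (ha : k + a ≤ maxLetter u) : a = numValues u x (i + 1) := by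
  have : ({j | x j = i + 1} : Finset (Fin n)).image u = Ioc k (k + a) := by
    ext c
    simp only [mem_image, mem_filter, mem_univ, true_and, mem_Ioc]
    constructor
    · rintro ⟨j, hj, rfl⟩
      exact (h j).2 hj
    · intro hc
      obtain ⟨j, rfl⟩ := exists_eq_of_le_maxLetter hu (by omega : 1 ≤ c) (by omega)
      exact ⟨j, (h j).1 hc, rfl⟩
  rw [numValues, this, Nat.card_Ioc]
  omega

/-- By monotonicity, the letters of `u` at the positions where `x` is `i + 1` form an initial
interval of the letters above `k`. -/
theorem MonoAbove.exists_isBlock {n : ℕ} {u x : Fin n → ℕ} {k i : ℕ} (hk : k ≤ maxLetter u)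
    (hi : ∀ j, u j ≤ k ↔ x j ≤ i) (h : MonoAbove u x i) :
    ∃ a, k + a ≤ maxLetter u ∧ IsBlock u x k i a := by
  have hle : ∀ j, u j ≤ maxLetter u := fun j => le_sup (mem_univ j)
  -- The end of that interval, measured from `k`; it is `0` when `x` omits the letter `i + 1`.
  refine ⟨({j | x j = i + 1} : Finset (Fin n)).sup fun j => u j - k, ?_, fun j => ⟨?_, ?_⟩⟩
  · have : (({j | x j = i + 1} : Finset (Fin n)).sup fun j => u j - k) ≤ maxLetter u - k :=
      Finset.sup_le fun j _ => Nat.sub_le_sub_right (hle j) k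
    omega
  · rintro ⟨h1, h2⟩
    rcases (({j | x j = i + 1} : Finset (Fin n))).eq_empty_or_nonempty with h0 | h0
    · rw [h0, sup_empty, bot_eq_zero'] at h2
      omega
    · obtain ⟨l, hl, e⟩ := exists_mem_eq_sup _ h0 fun j => u j - k
      rw [e] at h2
      rw [mem_filter] at hl
      have h3 : i < x j := by
        by_contra h4
        have := (hi j).2 (by omega)
        omega
      have h5 : k < u l := by
        by_contra h4
        have := (hi l).1 (by omega)
        omega
      have := h j l (by omega) h3
      omega
  · intro hj
    have h1 : u j - k ≤ ({j | x j = i + 1} : Finset (Fin n)).sup fun j => u j - k :=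
      le_sup (f := fun j => u j - k) (by simpa using hj)
    have h2 : ¬u j ≤ k := fun h3 => by
      have := (hi j).1 h3
      omega
    omega

theorem IsBlock.le_iff {n : ℕ} {u x : Fin n → ℕ} {k i a : ℕ}
    (hi : ∀ j, u j ≤ k ↔ x j ≤ i) (h : IsBlock u x k i a) (j : Fin n) :
    u j ≤ k + a ↔ x j ≤ i + 1 := by
  have h1 := hi j
  have h2 := h j
  omega

/-- A position with `x_j = i + 1` imposes nothing new: by `hi`, a larger letter of `u` already has
`x > i`. -/
theorem monoAbove_succ_iff {n : ℕ} {u x : Fin n → ℕ} {k i : ℕ} (hi : ∀ j, u j ≤ k ↔ x j ≤ i) :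
    MonoAbove u x i ↔ MonoAbove u x (i + 1) := by
  refine ⟨fun h1 j l hjl hj => h1 j l hjl (by omega), fun h1 j l hjl hj => ?_⟩
  rcases Nat.lt_or_ge (i + 1) (x j) with h2 | h2
  · exact h1 j l hjl h2
  · have h3 := hi j
    have h4 := hi l
    omega

theorem splitSum_range' {B N : Type*} [AddCommMonoid N] (F : ℕ → B) (s t : ℕ)
    (g : List B → List B → N) : splitSum ((List.range' s t).map F) g =
      ∑ a ∈ range (t + 1), g ((List.range' s a).map F) ((List.range' (s + a) (t - a)).map F) := by
  induction t generalizing s g with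
  | zero => simp
  | succ t ih =>
    rw [List.range'_succ, List.map_cons, splitSum_cons, ih, sum_range_succ' _ (t + 1), add_comm]
    congr 1
    refine sum_congr rfl fun a _ => ?_
    rw [List.range'_succ, List.map_cons, add_assoc, add_comm 1 a, Nat.add_sub_add_right]

theorem sum_rowFn {n : ℕ} (u : Fin n → ℕ) (k a : ℕ) :
    ((List.range' (k + 1) a).map (rowFn u)).sum =
      fun j => if k < u j ∧ u j ≤ k + a then 1 else 0 := by
  induction a with
  | zero =>
    ext j
    simp
  | succ a ih =>
    rw [List.range'_1_concat, List.map_append, List.sum_append, ih]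
    ext j
    simp only [List.map_cons, List.map_nil, List.sum_singleton, Pi.add_apply, rowFn]
    split_ifs <;> omega

theorem sum_rowFn_eq_iff {n : ℕ} (u x : Fin n → ℕ) (k i a : ℕ) :
    ((List.range' (k + 1) a).map (rowFn u)).sum = rowFn x (i + 1) ↔ IsBlock u x k i a := by
  rw [sum_rowFn, funext_iff]
  refine forall_congr' fun j => ?_
  rw [rowFn]
  split_ifs <;> simp_all

open Classical in
-- Here `k` and `l` letters have been consumed by the first `i` target rows, and `d` rows remain.
-- `IsBlock` determines the length of the next block, so the double sum has at most one nonzero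
-- term; monotonicity decides whether there is one.
theorem contractPair_range' {R : Type*} [CommSemiring R] (ω : ℕ → ℕ → R) {m n : ℕ}
    {u x : Fin m → ℕ} {v y : Fin n → ℕ} (hu : IsPacked u) (hv : IsPacked v) (d i k l : ℕ)
    (hk : k ≤ maxLetter u) (hl : l ≤ maxLetter v) (hki : ∀ j, u j ≤ k ↔ x j ≤ i)
    (hli : ∀ j, v j ≤ l ↔ y j ≤ i) (hx : ∀ j, x j ≤ i + d) (hy : ∀ j, y j ≤ i + d) :
    contractPair ω ((List.range' (k + 1) (maxLetter u - k)).map (rowFn u))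
        ((List.range' (l + 1) (maxLetter v - l)).map (rowFn v))
        ((List.range' (i + 1) d).map fun c => (rowFn x c, rowFn y c)) =
      if MonoAbove u x i ∧ MonoAbove v y i then
        ∏ c ∈ Ioc i (i + d), ω (numValues u x c) (numValues v y c) else 0 := by
  induction d generalizing i k l with
  | zero =>
    have h1 : maxLetter u ≤ k := Finset.sup_le fun j _ => (hki j).2 (hx j)
    have h2 : maxLetter v ≤ l := Finset.sup_le fun j _ => (hli j).2 (hy j)
    have h3 : MonoAbove u x i := fun j _ _ h => absurd h (not_lt.2 (hx j))
    have h4 : MonoAbove v y i := fun j _ _ h => absurd h (not_lt.2 (hy j))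
    rw [if_pos ⟨h3, h4⟩, Nat.sub_eq_zero_of_le h1, Nat.sub_eq_zero_of_le h2]
    simp [contractPair]
  | succ d ih =>
    rw [List.range'_succ, List.map_cons, contractPair, splitSum_range']
    simp only [splitSum_range', sum_rowFn_eq_iff, List.length_map, List.length_range']
    have key : ∀ a ∈ range (maxLetter u - k + 1), ∀ b ∈ range (maxLetter v - l + 1),
        IsBlock u x k i a → IsBlock v y l i b →
        contractPair ω ((List.range' (k + 1 + a) (maxLetter u - k - a)).map (rowFn u))
          ((List.range' (l + 1 + b) (maxLetter v - l - b)).map (rowFn v))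
          ((List.range' (i + 1 + 1) d).map fun c => (rowFn x c, rowFn y c)) =
        if MonoAbove u x i ∧ MonoAbove v y i then
          ∏ c ∈ Ioc (i + 1) (i + 1 + d), ω (numValues u x c) (numValues v y c) else 0 := by
      intro a ha b hb hua hvb
      rw [mem_range] at ha hb
      rw [monoAbove_succ_iff hki, monoAbove_succ_iff hli,
        ← ih (i + 1) (k + a) (l + b) (by omega) (by omega) (hua.le_iff hki) (hvb.le_iff hli)
          (fun j => (hx j).trans (by omega)) (fun j => (hy j).trans (by omega)),
        add_right_comm k, add_right_comm l, Nat.sub_sub, Nat.sub_sub]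
    by_cases hm : MonoAbove u x i ∧ MonoAbove v y i
    · obtain ⟨a, ha, hua⟩ := hm.1.exists_isBlock hk hki
      obtain ⟨b, hb, hvb⟩ := hm.2.exists_isBlock hl hli
      have ha' : a ∈ range (maxLetter u - k + 1) := mem_range.2 (by omega)
      have hb' : b ∈ range (maxLetter v - l + 1) := mem_range.2 (by omega)
      rw [sum_eq_single_of_mem a ha', sum_eq_single_of_mem b hb', if_pos ⟨hua, hvb⟩,
        key a ha' b hb' hua hvb, if_pos hm, if_pos hm, hua.eq_numValues hu ha,
        hvb.eq_numValues hv hb, ← prod_Ioc_consecutive _ (Nat.le_succ i) (by omega :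
          i + 1 ≤ i + (d + 1))]
      · simp [add_assoc, add_comm 1 d]
      · intro b' hb'' hne
        refine if_neg fun h => hne ?_
        rw [mem_range] at hb''
        rw [hvb.eq_numValues hv hb, h.2.eq_numValues hv (by omega)]
      · intro a' ha'' hne
        refine sum_eq_zero fun b' _ => if_neg fun h => hne ?_
        rw [mem_range] at ha''
        rw [hua.eq_numValues hu ha, h.1.eq_numValues hu (by omega)]
    · rw [if_neg hm]
      refine sum_eq_zero fun a ha => sum_eq_zero fun b hb => ?_
      split_ifs with h
      -- Even if the next pair of blocks fits, the failure of monotonicity persists in the remaining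
      -- rows.
      · rw [key a ha b hb h.1 h.2, if_neg hm, mul_zero]
      · rfl

/-- The condition under which `x` is the image of `u` under a weakly increasing map. -/
def IsMono {n : ℕ} (u x : Fin n → ℕ) : Prop := ∀ j k, u j ≤ u k → x j ≤ x k

theorem monoAbove_zero_iff {n : ℕ} {u x : Fin n → ℕ} (hx : ∀ j, 1 ≤ x j) :
    MonoAbove u x 0 ↔ IsMono u x :=
  ⟨fun h j k hjk => h j k hjk (hx j), fun h j k hjk _ => h j k hjk⟩

open Classical in
theorem contractPair_rowList {R : Type*} [CommSemiring R] (ω : ℕ → ℕ → R) {m n : ℕ}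
    {u x : Fin m → ℕ} {v y : Fin n → ℕ} (hu : IsPacked u) (hv : IsPacked v) (r : ℕ)
    (hx : ∀ j, 1 ≤ x j ∧ x j ≤ r) (hy : ∀ j, 1 ≤ y j ∧ y j ≤ r) :
    contractPair ω (rowList u (maxLetter u)) (rowList v (maxLetter v))
        ((List.range' 1 r).map fun c => (rowFn x c, rowFn y c)) =
      if IsMono u x ∧ IsMono v y then
        ∏ c ∈ Icc 1 r, ω (numValues u x c) (numValues v y c) else 0 := by
  have := contractPair_range' ω hu hv r 0 0 0 (Nat.zero_le _) (Nat.zero_le _) (x := x) (y := y)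
    (fun j => by have := (hu j).1; have := (hx j).1; omega)
    (fun j => by have := (hv j).1; have := (hy j).1; omega)
    (fun j => by have := (hx j).2; omega) (fun j => by have := (hy j).2; omega)
  rw [monoAbove_zero_iff fun j => (hx j).1, monoAbove_zero_iff fun j => (hy j).1] at this
  simpa only [zero_add, Nat.sub_zero] using! this

theorem contractPair_nil {R A B : Type*} [CommSemiring R] [AddCommMonoid A] [AddCommMonoid B]
    (h : ℕ → R) (U : List A) (W : List (A × B)) (hW : ∀ p ∈ W, p.2 = 0) :
    contractPair (fun a _ => h a) U ([] : List B) W = contract h U (W.map Prod.fst) := by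
  induction W generalizing U with
  | nil => simp [contractPair, contract]
  | cons q W ih =>
    rw [contractPair, List.map_cons, contract]
    refine splitSum_congr fun U₁ U₂ _ => ?_
    rw [splitSum_nil, ih U₂ fun p hp => hW p (by simp [hp]), hW q (by simp)]
    by_cases hq : U₁.sum = q.1
    · rw [if_pos ⟨hq, rfl⟩, if_pos hq]
    · rw [if_neg fun h => hq h.1, if_neg hq]

open Classical in
theorem contract_rowList {R : Type*} [CommSemiring R] (h : ℕ → R) {n : ℕ}
    {u x : Fin n → ℕ} (hu : IsPacked u) (r : ℕ) (hx : ∀ j, 1 ≤ x j ∧ x j ≤ r) :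
    contract h (rowList u (maxLetter u)) (rowList x r) =
      if IsMono u x then ∏ c ∈ Icc 1 r, h (numValues u x c) else 0 := by
  -- The case of one word follows from that of two by taking the second word empty.
  have h1 := contractPair_rowList (fun a _ => h a) hu (v := (Fin.elim0 : Fin 0 → ℕ))
    (y := (Fin.elim0 : Fin 0 → ℕ)) (fun j => j.elim0) r hx fun j => j.elim0
  have h2 : IsMono (Fin.elim0 : Fin 0 → ℕ) Fin.elim0 := fun j => j.elim0
  have h3 : rowList (Fin.elim0 : Fin 0 → ℕ) (maxLetter (Fin.elim0 : Fin 0 → ℕ)) = [] := by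
    simp [rowList, maxLetter]
  rw [h3, contractPair_nil] at h1
  · simpa [h2, rowList, Function.comp_def] using h1
  · intro p _
    exact Subsingleton.elim _ _

/-! ### Matrices of packed words -/

/-- A row of length `n`, with `p` zeros inserted on its left. -/
def rowEmb (p n : ℕ) : (Fin n → ℕ) →+ Row where
  toFun g := ∑ j : Fin n, Finsupp.single (p + (j : ℕ)) (g j)
  map_zero' := by simp
  map_add' g g' := by simp [sum_add_distrib]

theorem rowEmb_apply_add (p : ℕ) {n : ℕ} (g : Fin n → ℕ) (j : Fin n) :
    rowEmb p n g (p + j) = g j := by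
  simp only [rowEmb, AddMonoidHom.coe_mk, ZeroHom.coe_mk, Finsupp.coe_finsetSum, Finset.sum_apply]
  rw [sum_eq_single_of_mem j (mem_univ _)]
  · simp
  · intro k _ hk
    refine Finsupp.single_eq_of_ne fun h => hk (Fin.ext ?_)
    omega

theorem rowEmb_apply_of_lt {p n q : ℕ} (g : Fin n → ℕ) (h : q < p) : rowEmb p n g q = 0 := by
  simp only [rowEmb, AddMonoidHom.coe_mk, ZeroHom.coe_mk, Finsupp.coe_finsetSum, Finset.sum_apply]
  refine sum_eq_zero fun k _ => Finsupp.single_eq_of_ne fun h => ?_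
  omega

theorem rowEmb_apply_of_le {p n q : ℕ} (g : Fin n → ℕ) (h : p + n ≤ q) : rowEmb p n g q = 0 := by
  simp only [rowEmb, AddMonoidHom.coe_mk, ZeroHom.coe_mk, Finsupp.coe_finsetSum, Finset.sum_apply]
  refine sum_eq_zero fun k _ => Finsupp.single_eq_of_ne fun h => ?_
  omega

theorem rowEmb_injective (p n : ℕ) : Function.Injective (rowEmb p n) := by
  intro g g' h
  ext j
  rw [← rowEmb_apply_add p g j, h, rowEmb_apply_add]

/-- The two embeddings occupy disjoint columns; this is the independence of letters that the shift
provides. -/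
theorem rowEmb_add_injective {m n : ℕ} (a : Fin m → ℕ) (b : Fin n → ℕ) (a' : Fin m → ℕ)
    (b' : Fin n → ℕ) (h : rowEmb 0 m a + rowEmb m n b = rowEmb 0 m a' + rowEmb m n b') :
    a = a' ∧ b = b' := by
  constructor
  · ext j
    have := DFunLike.congr_fun h (0 + (j : ℕ))
    simpa only [Finsupp.add_apply, rowEmb_apply_add,
      rowEmb_apply_of_lt _ (by have := j.2; omega : 0 + (j : ℕ) < m), add_zero] using this
  · ext j
    have := DFunLike.congr_fun h (m + (j : ℕ))
    simpa only [Finsupp.add_apply, rowEmb_apply_add,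
      rowEmb_apply_of_le _ (by omega : 0 + m ≤ m + (j : ℕ)), zero_add] using this

theorem toMatrix_eq {n : ℕ} (u : PackedWord n) :
    toMatrix u = (rowList u.1 (maxLetter u.1)).map (rowEmb 0 n) := by
  rw [toMatrix, rowList, List.map_map, List.range'_eq_map_range, List.map_map]
  refine List.map_congr_left fun i _ => ?_
  simp only [Function.comp, rowEmb, AddMonoidHom.coe_mk, ZeroHom.coe_mk, rowFn, zero_add,
    add_comm 1 i]
  refine sum_congr rfl fun j _ => ?_
  split_ifs <;> simp

theorem shift_toMatrix {n : ℕ} (m : ℕ) (u : PackedWord n) :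
    shift m (toMatrix u) = (rowList u.1 (maxLetter u.1)).map (rowEmb m n) := by
  rw [toMatrix_eq, shift, List.map_map]
  refine List.map_congr_left fun g _ => ?_
  simp only [Function.comp, rowEmb, AddMonoidHom.coe_mk, ZeroHom.coe_mk, zero_add]
  rw [Finsupp.mapDomain_finsetSum]
  simp [Finsupp.mapDomain_single]

theorem toMatrix_eq_add {m n : ℕ} (w : PackedWord (m + n)) :
    toMatrix w = ((List.range' 1 (maxLetter w.1)).map fun c =>
      (rowFn (fun j => w.1 (Fin.castAdd n j)) c, rowFn (fun j => w.1 (Fin.natAdd m j)) c)).map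
        fun p => rowEmb 0 m p.1 + rowEmb m n p.2 := by
  rw [toMatrix_eq, rowList, List.map_map, List.map_map]
  refine List.map_congr_left fun i _ => ?_
  simp only [Function.comp, rowEmb, AddMonoidHom.coe_mk, ZeroHom.coe_mk, rowFn, zero_add]
  rw [Fin.sum_univ_add]
  simp

theorem le_maxLetter {n : ℕ} (x : Fin n → ℕ) (j : Fin n) : x j ≤ maxLetter x :=
  le_sup (mem_univ j)

theorem toMatrix_injective (n : ℕ) : Function.Injective (toMatrix (n := n)) := by
  intro u v h
  rw [toMatrix_eq, toMatrix_eq] at h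
  have h1 := (rowEmb_injective 0 n).list_map h
  have h2 : maxLetter u.1 = maxLetter v.1 := by
    have := congrArg List.length h1
    simpa [rowList] using this
  rw [rowList, rowList, h2, List.map_inj_left] at h1
  refine Subtype.ext (funext fun j => ?_)
  have := congrFun (h1 (u.1 j) (List.mem_range'_1.2 ⟨(u.2 j).1, ?_⟩)) j
  · rw [rowFn, rowFn, if_pos rfl] at this
    by_contra hne
    rw [if_neg (Ne.symm hne)] at this
    exact one_ne_zero this
  · have := le_maxLetter u.1 j
    omega

theorem exists_unique_one {ι : Type*} [DecidableEq ι] {s : Finset ι} {g : ι → ℕ}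
    (h : ∑ i ∈ s, g i = 1) : ∃ i ∈ s, g i = 1 ∧ ∀ j ∈ s, j ≠ i → g j = 0 := by
  obtain ⟨i, hi, h0⟩ := exists_ne_zero_of_sum_ne_zero (h ▸ one_ne_zero)
  rw [← add_sum_erase s g hi] at h
  have h1 : ∑ x ∈ s.erase i, g x = 0 := by omega
  refine ⟨i, hi, by omega, fun j hj hne => ?_⟩
  exact (sum_eq_zero_iff.1 h1) j (mem_erase.2 ⟨hne, hj⟩)

/-- The matrices of packed words of length `n` are those with nonzero rows of sum `(1, …, 1)`. -/
theorem exists_eq_toMatrix {n : ℕ} {P : List Row} (h0 : ∀ a ∈ P, a ≠ 0)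
    (hs : P.sum = rowEmb 0 n 1) : ∃ w : PackedWord n, P = toMatrix w := by
  have hcol : ∀ q, ∑ i : Fin P.length, P[i] q = rowEmb 0 n 1 q := by
    intro q
    rw [← hs, ← Fin.sum_univ_getElem, Finsupp.coe_finsetSum, Finset.sum_apply]
    rfl
  -- A column of nonnegative integers with sum `1` has exactly one nonzero entry; its row gives the
  -- `j`-th letter. Nonzero rows will make every letter occur.
  have h1 : ∀ j : Fin n, ∃ i : Fin P.length, P[i] j = 1 ∧
      ∀ i' : Fin P.length, i' ≠ i → P[i'] j = 0 := by
    intro j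
    have h2 := hcol (0 + j)
    rw [rowEmb_apply_add, zero_add] at h2
    obtain ⟨i, -, h3, h4⟩ := exists_unique_one h2
    exact ⟨i, h3, fun i' => h4 i' (mem_univ _)⟩
  choose p hp1 hp0 using h1
  have hrow : ∀ i : Fin P.length, P[i] = rowEmb 0 n (rowFn (fun j => (p j : ℕ) + 1) (i + 1)) := by
    intro i
    ext q
    rcases Nat.lt_or_ge q n with hq | hq
    · have := rowEmb_apply_add 0 (rowFn (fun j => (p j : ℕ) + 1) (i + 1)) ⟨q, hq⟩
      rw [zero_add] at this
      rw [this, rowFn]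
      split_ifs with h
      · have e : p ⟨q, hq⟩ = i := Fin.ext (by simpa using h)
        rw [← e]
        exact hp1 ⟨q, hq⟩
      · exact hp0 ⟨q, hq⟩ i fun e => h (by rw [e])
    · rw [rowEmb_apply_of_le _ (by omega)]
      have := hcol q
      rw [rowEmb_apply_of_le _ (by omega), sum_eq_zero_iff] at this
      exact this i (mem_univ _)
  have hsurj : ∀ i : Fin P.length, ∃ j, p j = i := by
    intro i
    by_contra! hne
    refine h0 P[i] (List.getElem_mem _) ?_
    rw [hrow]
    have : rowFn (fun j => (p j : ℕ) + 1) (i + 1) = 0 := by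
      ext j
      rw [rowFn, if_neg, Pi.zero_apply]
      exact fun h => hne j (Fin.ext (by simpa using h))
    rw [this, map_zero]
  have hpack : IsPacked fun j => (p j : ℕ) + 1 := by
    refine fun j => ⟨Nat.le_add_left 1 _, fun i hi1 hi2 => ?_⟩
    dsimp only at hi2
    obtain ⟨k, hk⟩ := hsurj ⟨i - 1, by have := (p j).2; omega⟩
    refine ⟨k, ?_⟩
    simp only [hk]
    omega
  have hmax : maxLetter (fun j => (p j : ℕ) + 1) = P.length := by
    refine le_antisymm (Finset.sup_le fun j _ => (p j).2) ?_
    rcases Nat.eq_zero_or_pos P.length with h | h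
    · omega
    · obtain ⟨j, hj⟩ := hsurj ⟨P.length - 1, by omega⟩
      have := le_maxLetter (fun j => (p j : ℕ) + 1) j
      simp only [hj] at this
      omega
  refine ⟨⟨_, hpack⟩, ?_⟩
  rw [toMatrix_eq, rowList, List.map_map]
  refine List.ext_getElem (by simp [hmax]) fun i hi _ => ?_
  rw [List.getElem_map, List.getElem_range']
  have := hrow ⟨i, hi⟩
  simpa [add_comm] using this

theorem sum_rowList {n : ℕ} {u : Fin n → ℕ} (hu : IsPacked u) :
    (rowList u (maxLetter u)).sum = 1 := by
  rw [rowList]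
  refine (sum_rowFn u 0 _).trans ?_
  ext j
  have h1 := (hu j).1
  have h2 := le_maxLetter u j
  rw [if_pos (by omega), Pi.one_apply]

/-- The degree of a row. -/
def rowDegree (n : ℕ) : (Fin n → ℕ) →+ ℕ where
  toFun g := ∑ j, g j
  map_zero' := by simp
  map_add' g g' := by simp [sum_add_distrib]

theorem rowDegree_rowFn {n : ℕ} (u : Fin n → ℕ) (i : ℕ) :
    rowDegree n (rowFn u i) = #{j | u j = i} := by
  simp [rowDegree, rowFn]

theorem rowDegree_pos {n : ℕ} {u : Fin n → ℕ} (hu : IsPacked u) :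
    ∀ g ∈ rowList u (maxLetter u), 0 < rowDegree n g := by
  intro g hg
  obtain ⟨i, hi, rfl⟩ := List.mem_map.1 hg
  rw [List.mem_range'_1] at hi
  obtain ⟨k, hk⟩ := exists_eq_of_le_maxLetter hu hi.1 (by omega)
  rw [rowDegree_rowFn]
  exact card_pos.2 ⟨k, by simpa using hk⟩

theorem ev_blocks {n : ℕ} (u : PackedWord n) :
    (ev u).blocks = (rowList u.1 (maxLetter u.1)).map (rowDegree n) := by
  rw [ev, rowList, List.map_map, List.range'_eq_map_range, List.map_map]
  refine List.map_congr_left fun i _ => ?_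
  simp only [Function.comp, rowDegree_rowFn, add_comm 1 i]

theorem contract_ev {K : Type*} [Field K] (h : ℕ → K) {n : ℕ} {u v : PackedWord n}
    (huv : Coarser v u) : contract h (ev u).blocks (ev v).blocks =
      contract h (rowList u.1 (maxLetter u.1)) (rowList v.1 (maxLetter v.1)) := by
  classical
  rw [ev_blocks, ev_blocks]
  -- With all weights `1` the contraction equals `1` for `v` coarser than `u`, which certifies that
  -- the decomposition exists.
  refine contract_map (h' := fun _ => 1) h _ (rowDegree_pos u.2) ?_
  rw [contract_rowList _ u.2 _ fun j => ⟨(v.2 j).1, le_maxLetter _ j⟩, if_pos (show IsMono u.1 v.1 from huv),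
    prod_const_one]
  exact one_ne_zero

theorem contract_rowList_of_not_coarser {K : Type*} [Field K] (h : ℕ → K) {n : ℕ}
    {u v : PackedWord n} (huv : ¬Coarser v u) :
    contract h (rowList u.1 (maxLetter u.1)) (rowList v.1 (maxLetter v.1)) = 0 := by
  classical
  rw [contract_rowList _ u.2 _ fun j => ⟨(v.2 j).1, le_maxLetter _ j⟩]
  exact if_neg huv

/-! ### Packing -/

theorem pack_le_pack_iff {n : ℕ} (x : Fin n → ℕ) (j k : Fin n) :
    pack x j ≤ pack x k ↔ x j ≤ x k := by
  constructor
  · intro h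
    by_contra! hlt
    refine absurd h (not_le.2 (card_lt_card ?_))
    rw [ssubset_iff_of_subset fun a ha => ?_]
    · exact ⟨x j, by simp, by simpa using hlt⟩
    · rw [mem_filter] at ha ⊢
      exact ⟨ha.1, by omega⟩
  · intro h
    refine card_le_card fun a ha => ?_
    rw [mem_filter] at ha ⊢
    exact ⟨ha.1, by omega⟩

theorem pack_eq_pack_iff {n : ℕ} (x : Fin n → ℕ) (j k : Fin n) :
    pack x j = pack x k ↔ x j = x k := by
  rw [le_antisymm_iff, le_antisymm_iff, pack_le_pack_iff, pack_le_pack_iff]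

theorem pack_pos {n : ℕ} (x : Fin n → ℕ) (j : Fin n) : 1 ≤ pack x j :=
  card_pos.2 ⟨x j, by simp⟩

theorem isPacked_pack {n : ℕ} (x : Fin n → ℕ) : IsPacked (pack x) := by
  have h1 : univ.image (pack x) ⊆ Icc 1 (#(univ.image x)) := by
    intro c hc
    obtain ⟨j, -, rfl⟩ := mem_image.1 hc
    exact mem_Icc.2 ⟨pack_pos x j, card_le_card (filter_subset _ _)⟩
  have h2 : #(univ.image (pack x)) = #(univ.image x) := by
    refine (card_bij (fun a _ => #{b ∈ univ.image x | b ≤ a}) ?_ ?_ ?_).symm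
    · intro a ha
      obtain ⟨j, -, rfl⟩ := mem_image.1 ha
      exact mem_image.2 ⟨j, mem_univ _, rfl⟩
    · intro a ha b hb h
      obtain ⟨j, -, rfl⟩ := mem_image.1 ha
      obtain ⟨k, -, rfl⟩ := mem_image.1 hb
      exact (pack_eq_pack_iff x j k).1 h
    · intro c hc
      obtain ⟨j, -, rfl⟩ := mem_image.1 hc
      exact ⟨x j, by simp, rfl⟩
  -- The ranks are distinct on distinct letters, so they fill the whole interval.
  have h3 := eq_of_subset_of_card_le h1 (by rw [h2, Nat.card_Icc]; omega)
  refine fun j => ⟨pack_pos x j, fun i hi1 hi2 => ?_⟩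
  have h4 : pack x j ∈ Icc 1 (#(univ.image x)) := h1 (mem_image_of_mem _ (mem_univ j))
  have h5 : i ∈ univ.image (pack x) := by
    rw [h3, mem_Icc]
    exact ⟨hi1, hi2.trans (mem_Icc.1 h4).2⟩
  obtain ⟨k, -, hk⟩ := mem_image.1 h5
  exact ⟨k, hk⟩

theorem prod_numValues_eq_prod_image {R : Type*} [CommSemiring R] {h : ℕ → R} (h0 : h 0 = 1)
    {n : ℕ} (u x : Fin n → ℕ) (r : ℕ) (hx : ∀ j, 1 ≤ x j ∧ x j ≤ r) :
    ∏ c ∈ Icc 1 r, h (numValues u x c) = ∏ c ∈ univ.image x, h (numValues u x c) := by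
  symm
  refine prod_subset ?_ ?_
  · intro c hc
    obtain ⟨j, -, rfl⟩ := mem_image.1 hc
    exact mem_Icc.2 (hx j)
  · intro c _ hc
    have : ({j | x j = c} : Finset (Fin n)) = ∅ := by
      refine filter_eq_empty_iff.2 fun j _ hj => hc ?_
      rw [← hj]
      exact mem_image_of_mem _ (mem_univ j)
    rw [numValues, this, image_empty, card_empty, h0]

/-- Letters missing from `x` give zero rows, each contributing `h 0 = 1`, so packing changes
nothing. This applies to the left and right parts of a packed word, which need not be packed. -/
theorem contract_rowList_pack {R : Type*} [CommSemiring R] {h : ℕ → R} (h0 : h 0 = 1) {n : ℕ}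
    {u x : Fin n → ℕ} (hu : IsPacked u) (r : ℕ) (hx : ∀ j, 1 ≤ x j ∧ x j ≤ r) :
    contract h (rowList u (maxLetter u)) (rowList x r) =
      contract h (rowList u (maxLetter u)) (rowList (pack x) (maxLetter (pack x))) := by
  classical
  have hp : ∀ j, 1 ≤ pack x j ∧ pack x j ≤ maxLetter (pack x) :=
    fun j => ⟨pack_pos x j, le_maxLetter _ j⟩
  rw [contract_rowList h hu r hx, contract_rowList h hu _ hp]
  refine if_congr (by simp only [IsMono, pack_le_pack_iff]) ?_ rfl
  rw [prod_numValues_eq_prod_image h0 u x r hx, prod_numValues_eq_prod_image h0 u _ _ hp]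
  refine prod_bij (fun a _ => #{b ∈ univ.image x | b ≤ a}) ?_ ?_ ?_ ?_
  · intro a ha
    obtain ⟨j, -, rfl⟩ := mem_image.1 ha
    exact mem_image.2 ⟨j, mem_univ _, rfl⟩
  · intro a ha b hb h
    obtain ⟨j, -, rfl⟩ := mem_image.1 ha
    obtain ⟨k, -, rfl⟩ := mem_image.1 hb
    exact (pack_eq_pack_iff x j k).1 h
  · intro c hc
    obtain ⟨j, -, rfl⟩ := mem_image.1 hc
    exact ⟨x j, by simp, rfl⟩
  · intro a ha
    obtain ⟨j, -, rfl⟩ := mem_image.1 ha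
    congr 1
    rw [numValues, numValues]
    congr 2
    ext k
    simp only [mem_filter, mem_univ, true_and]
    exact (pack_eq_pack_iff x k j).symm

/-! ### Coefficients of the shifted quasi-shuffle -/

section shifted

variable {R : Type*} [CommSemiring R] (α β : R) {m n : ℕ} (u : PackedWord m) (v : PackedWord n)

theorem row_add_eq_zero (a b : Row) (h : a + b = 0) : a = 0 ∧ b = 0 := by
  constructor <;> ext q <;> have := DFunLike.congr_fun h q <;>
    simp only [Finsupp.add_apply, Finsupp.coe_zero, Pi.zero_apply] at this ⊢ <;> omega

theorem rowEmb_ne_zero {p n : ℕ} {u : Fin n → ℕ} (hu : IsPacked u) :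
    ∀ a ∈ (rowList u (maxLetter u)).map (rowEmb p n), a ≠ 0 := by
  intro a ha h0
  obtain ⟨g, hg, rfl⟩ := List.mem_map.1 ha
  have h1 := rowDegree_pos hu g hg
  rw [(map_eq_zero_iff _ (rowEmb_injective p n)).1 h0, map_zero] at h1
  exact lt_irrefl _ h1

theorem exists_toMatrix_of_mem_support {P : List Row}
    (hP : P ∈ (shiftedQuasiShuffle α β u v).support) :
    ∃ w : PackedWord (m + n), P = toMatrix w := by
  rw [shiftedQuasiShuffle, toMatrix_eq, shift_toMatrix] at hP
  obtain ⟨h1, h2⟩ := quasiShuffle_support row_add_eq_zero hP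
  refine exists_eq_toMatrix (h2 (rowEmb_ne_zero u.2) (rowEmb_ne_zero v.2)) ?_
  rw [h1, ← map_list_sum, ← map_list_sum, sum_rowList u.2, sum_rowList v.2]
  simp only [rowEmb, AddMonoidHom.coe_mk, ZeroHom.coe_mk, zero_add, Fin.sum_univ_add]
  simp

theorem numValues_eq_zero_iff {n : ℕ} (u x : Fin n → ℕ) (i : ℕ) :
    numValues u x i = 0 ↔ ∀ j, x j ≠ i := by
  simp [numValues, filter_eq_empty_iff]

theorem shiftedQuasiShuffle_toMatrix (w : PackedWord (m + n)) :
    shiftedQuasiShuffle α β u v (toMatrix w) = f α β u v w := by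
  classical
  have hw : ∀ j, 1 ≤ w.1 j ∧ w.1 j ≤ maxLetter w.1 :=
    fun j => ⟨(w.2 j).1, le_maxLetter _ j⟩
  rw [shiftedQuasiShuffle, toMatrix_eq u, shift_toMatrix, toMatrix_eq_add,
    quasiShuffle_apply _ _ rowEmb_add_injective,
    contractPair_rowList _ u.2 v.2 _ (fun j => hw _) (fun j => hw _), f]
  refine (if_congr ?_ ?_ rfl).trans (ite_not _ _ _)
  · simp only [IsMono, not_or, not_exists, not_and, not_lt]
  · refine prod_congr rfl fun i hi => ?_
    rw [mem_Icc] at hi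
    -- Every letter `i ≤ max w` occurs in the left or the right part of `w`, so the two counts are
    -- not both `0`.
    rw [blockWeight, if_neg]
    rintro ⟨h1, h2⟩
    rw [numValues_eq_zero_iff] at h1 h2
    obtain ⟨k, hk⟩ := exists_eq_of_le_maxLetter w.2 hi.1 hi.2
    exact Fin.addCases (motive := fun k => w.1 k ≠ i) h1 h2 k hk

theorem factor_one_le_one (a b : ℕ) : factor (1 : ℕ) 1 a b ≤ 1 := by
  rw [factor]
  split_ifs <;> simp

theorem shiftedQuasiShuffle_one_le_one (P : List Row) :
    shiftedQuasiShuffle (1 : ℕ) 1 u v P ≤ 1 := by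
  by_cases hP : P ∈ (shiftedQuasiShuffle (1 : ℕ) 1 u v).support
  · obtain ⟨w, rfl⟩ := exists_toMatrix_of_mem_support 1 1 u v hP
    rw [shiftedQuasiShuffle_toMatrix, f]
    split_ifs
    · exact zero_le_one
    · exact prod_le_one' fun i _ => factor_one_le_one _ _
  · rw [Finsupp.notMem_support_iff.1 hP]
    exact zero_le_one

end shifted

/-! ### The basis `𝐗` and its product -/

section X

variable {K : Type*} [Field K] [CharZero K] (s t : K)

theorem X_eq_sum {n : ℕ} (u : PackedWord n) : X s t u = ∑ w : PackedWord n,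
    contract (expCoeff (s + t) (s * t)) (rowList u.1 (maxLetter u.1))
      (rowList w.1 (maxLetter w.1)) • M K w := by
  classical
  rw [X, sum_filter]
  refine sum_congr rfl fun w _ => ?_
  split_ifs with h
  · rw [c_eq_contract, contract_ev _ h]
  · rw [contract_rowList_of_not_coarser _ h, zero_smul]

theorem mul_sum_M {K ι κ : Type*} [Field K] (p : Finset ι) (q : Finset κ) {m n : ℕ} (a : ι → K)
    (b : κ → K) (u : ι → PackedWord m) (v : κ → PackedWord n) :
    mul (∑ i ∈ p, a i • M K (u i)) (∑ j ∈ q, b j • M K (v j)) =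
      ∑ i ∈ p, ∑ j ∈ q, (a i * b j) • mulM K (u i) (v j) := by
  rw [mul, ← Finsupp.sum_finsetSum_index]
  · refine sum_congr rfl fun i _ => ?_
    rw [M, Finsupp.smul_single_one, Finsupp.sum_single_index, ← Finsupp.sum_finsetSum_index]
    · refine sum_congr rfl fun j _ => ?_
      rw [M, Finsupp.smul_single_one, Finsupp.sum_single_index]
      simp
    · simp
    · intros
      rw [mul_add, add_smul]
    · simp
  · simp
  · intro w r r'
    simp only [add_mul, add_smul, Finsupp.sum_add]

/-- A given `w` occurs in `𝐌_{u'} 𝐌_{v'}` only when `u'` and `v'` are the packings of its two parts.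
-/
theorem mul_X (m n : ℕ) (u : PackedWord m) (v : PackedWord n) :
    mul (X s t u) (X s t v) = ∑ w : PackedWord (m + n),
      (contract (expCoeff (s + t) (s * t)) (rowList u.1 (maxLetter u.1))
          (rowList (fun j => w.1 (Fin.castAdd n j)) (maxLetter w.1)) *
        contract (expCoeff (s + t) (s * t)) (rowList v.1 (maxLetter v.1))
          (rowList (fun j => w.1 (Fin.natAdd m j)) (maxLetter w.1))) • M K w := by
  classical
  rw [X_eq_sum, X_eq_sum, mul_sum_M]
  simp only [mulM, smul_sum, sum_filter]
  rw [← sum_product', sum_comm]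
  refine sum_congr rfl fun w _ => ?_
  have hw : ∀ j, 1 ≤ w.1 j ∧ w.1 j ≤ maxLetter w.1 :=
    fun j => ⟨(w.2 j).1, le_maxLetter _ j⟩
  rw [sum_eq_single_of_mem ((⟨_, isPacked_pack fun j => w.1 (Fin.castAdd n j)⟩,
    ⟨_, isPacked_pack fun j => w.1 (Fin.natAdd m j)⟩) : PackedWord m × PackedWord n)
    (mem_product.2 ⟨mem_univ _, mem_univ _⟩), if_pos ⟨rfl, rfl⟩]
  · rw [contract_rowList_pack rfl u.2 _ fun j => hw _,
      contract_rowList_pack rfl v.2 _ fun j => hw _]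
  · rintro ⟨u', v'⟩ - hne
    rw [if_neg, smul_zero]
    rintro ⟨h1, h2⟩
    exact hne (Prod.ext (Subtype.ext h1.symm) (Subtype.ext h2.symm))

/-- On the left, the coefficient of `𝐌_w` is the value on the quasi-shuffle of contraction along the
matrix of `w`; `shuffleEval_contract` factors it into the two contractions of `mul_X`. -/
theorem sum_shiftedQuasiShuffle_smul_X (m n : ℕ) (u : PackedWord m) (v : PackedWord n) :
    ∑ w : PackedWord (m + n), shiftedQuasiShuffle (s + t) (s * t) u v (toMatrix w) • X s t w =
      mul (X s t u) (X s t v) := by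
  classical
  rw [mul_X]
  simp only [X_eq_sum, smul_sum, smul_smul]
  rw [sum_comm]
  refine sum_congr rfl fun w _ => ?_
  rw [← sum_smul]
  congr 1
  have h1 : ∀ w' : PackedWord (m + n), contract (expCoeff (s + t) (s * t))
      (rowList w'.1 (maxLetter w'.1)) (rowList w.1 (maxLetter w.1)) =
        contract (expCoeff (s + t) (s * t)) (toMatrix w') (toMatrix w) := by
    intro w'
    rw [toMatrix_eq, toMatrix_eq]
    generalize rowList w'.1 (maxLetter w'.1) = P
    generalize rowList w.1 (maxLetter w.1) = W
    induction W generalizing P with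
    | nil => simp [contract]
    | cons q W ih =>
      rw [List.map_cons, contract, contract, splitSum_map]
      refine splitSum_congr fun P₁ P₂ _ => ?_
      rw [← map_list_sum, (rowEmb_injective 0 _).eq_iff, List.length_map, ih]
  simp only [h1]
  have h2 := shuffleEval_contract (rowEmb 0 m) (rowEmb m n) rowEmb_add_injective row_add_eq_zero
    (s + t) (s * t) (expCoeff (s + t) (s * t)) (shuffleEval_expCoeff _ _)
    (rowList u.1 (maxLetter u.1)) (rowList v.1 (maxLetter v.1))
    ((List.range' 1 (maxLetter w.1)).map fun c =>
      (rowFn (fun j => w.1 (Fin.castAdd n j)) c, rowFn (fun j => w.1 (Fin.natAdd m j)) c))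
  rw [← toMatrix_eq_add, List.map_map, List.map_map] at h2
  refine Eq.trans ?_ h2
  rw [shuffleEval, ← toMatrix_eq, ← shift_toMatrix, Finsupp.linearCombination_apply, Finsupp.sum]
  symm
  refine (sum_subset (s₂ := univ.image (toMatrix (n := m + n))) ?_ ?_).trans ?_
  · intro P hP
    obtain ⟨w', rfl⟩ := exists_toMatrix_of_mem_support _ _ u v hP
    exact mem_image_of_mem _ (mem_univ _)
  · intro P _ hP
    rw [Finsupp.notMem_support_iff.1 hP, zero_smul]
  · rw [sum_image (toMatrix_injective _).injOn]
    rfl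

/-! ### Triangularity of `𝐗` on `𝐌` and the basis property. -/

theorem Coarser.le {n : ℕ} {u v : PackedWord n} (h : Coarser v u) (j : Fin n) :
    v.1 j ≤ u.1 j := by
  induction hi : v.1 j using Nat.strong_induction_on generalizing j with
  | _ i ih =>
    rcases Nat.lt_or_ge 1 i with h1 | h1
    · obtain ⟨k, hk⟩ := (v.2 j).2 (i - 1) (by omega) (by omega)
      have h2 := ih (i - 1) (by omega) k hk
      have h3 : ¬u.1 j ≤ u.1 k := fun h4 => by
        have := h j k h4
        omega
      omega
    · exact h1.trans (u.2 j).1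

/-- `𝐗_u` is `𝐌_u` plus terms `𝐌_v` with `v` strictly coarser, and merging letters strictly
decreases the sum of the letters, on which the induction runs. -/
theorem M_mem_span {n : ℕ} (u : PackedWord n) :
    M K u ∈ Submodule.span K (Set.range fun w : PackedWord n => X s t w) := by
  classical
  induction hN : ∑ j, u.1 j using Nat.strong_induction_on generalizing u with
  | _ N ih =>
    have hr : Coarser u u := fun j k h => h
    have h1 : X s t u = M K u + ∑ v ∈ (univ : Finset (PackedWord n)).erase u,
        if Coarser v u then c s t (ev u) (ev v) • M K v else 0 := by
      rw [X, sum_filter, ← add_sum_erase _ _ (mem_univ u), if_pos hr,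
        c_eq_contract, contract_self rfl (AddMonoidHom.id ℕ) fun a ha => (ev u).blocks_pos ha,
        one_smul]
    rw [← sub_eq_iff_eq_add] at h1
    rw [← h1]
    refine Submodule.sub_mem _ (Submodule.subset_span ⟨u, rfl⟩) (Submodule.sum_mem _ fun v hv => ?_)
    split_ifs with h
    · refine Submodule.smul_mem _ _ (ih _ ?_ v rfl)
      rw [← hN]
      refine sum_lt_sum (fun j _ => h.le j) ?_
      by_contra! hle
      refine (mem_erase.1 hv).1 (Subtype.ext (funext fun j => ?_))
      exact le_antisymm (h.le j) (hle j (mem_univ _))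
    · exact Submodule.zero_mem _

theorem linearIndependent_X :
    LinearIndependent K (fun u : (Σ n, PackedWord n) => X s t u.2) :=
  linearIndependent_of_mem_span (b := fun u : (Σ n, PackedWord n) => M K u.2)
    (Finsupp.basisSingleOne (R := K) (ι := Σ n, PackedWord n)).linearIndependent
    fun _ u => M_mem_span s t u

theorem span_X :
    Submodule.span K (Set.range fun u : (Σ n, PackedWord n) => X s t u.2) = ⊤ := by
  rw [eq_top_iff, ← (Finsupp.basisSingleOne (R := K) (ι := Σ n, PackedWord n)).span_eq,
    Submodule.span_le]
  rintro _ ⟨⟨n, u⟩, rfl⟩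
  refine Submodule.span_mono ?_ (M_mem_span s t u)
  rintro _ ⟨w, rfl⟩
  exact ⟨⟨n, w⟩, rfl⟩

end X

end WQS

end

theorem mainTheorem5 {K : Type*} [Field K] [CharZero K] (s t : K) :
    -- `(Y ^ I)` is linearly independent and `c` expands the `S ^ J` on it, so that the family
    -- `X_I = ∑ J, c_{IJ} M_J` is the dual basis of `(Y ^ I)`
    (LinearIndependent K (fun I : (Σ n, Composition n) => WQS.YComp s t I.2) ∧
      ∀ (n : ℕ) (J : Composition n),
        WQS.SComp K J = ∑ I : Composition n, WQS.c s t I J • WQS.YComp s t I) ∧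
    -- `(𝐗_u)` is a basis of `WQSym`
    (LinearIndependent K (fun u : (Σ n, WQS.PackedWord n) => WQS.X s t u.2) ∧
      Submodule.span K (Set.range fun u : (Σ n, WQS.PackedWord n) => WQS.X s t u.2) = ⊤) ∧
    -- the product rule, with `α = s + t` and `β = s t`
    ∀ (m n : ℕ) (u : WQS.PackedWord m) (v : WQS.PackedWord n),
      -- the shifted quasi-shuffle of the matrices of `u` and `v` involves only matrices of
      -- packed words of length `m + n`, and it gives the product of `𝐗_u` and `𝐗_v`
      (∀ P ∈ (WQS.shiftedQuasiShuffle (s + t) (s * t) u v).support,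
        ∃ w : WQS.PackedWord (m + n), P = WQS.toMatrix w) ∧
      WQS.mul (WQS.X s t u) (WQS.X s t v) =
        ∑ w : WQS.PackedWord (m + n),
          WQS.shiftedQuasiShuffle (s + t) (s * t) u v (WQS.toMatrix w) • WQS.X s t w ∧
      -- multiplicity-freeness: as a polynomial in `α`, `β`, each coefficient has natural
      -- coefficients, and their sum, which is its value at `α = β = 1`, is at most `1`
      (∀ P : List WQS.Row, WQS.shiftedQuasiShuffle (1 : ℕ) 1 u v P ≤ 1) ∧
      -- the explicit coefficients
      ∀ w : WQS.PackedWord (m + n),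
        WQS.shiftedQuasiShuffle (s + t) (s * t) u v (WQS.toMatrix w) =
          WQS.f (s + t) (s * t) u v w := by
  refine ⟨⟨WQS.linearIndependent_YComp s t, fun n J => ?_⟩,
    ⟨WQS.linearIndependent_X s t, WQS.span_X s t⟩, fun m n u v =>
    ⟨fun P hP => WQS.exists_toMatrix_of_mem_support _ _ u v hP,
      (WQS.sum_shiftedQuasiShuffle_smul_X s t m n u v).symm,
      WQS.shiftedQuasiShuffle_one_le_one u v,
      WQS.shiftedQuasiShuffle_toMatrix _ _ u v⟩⟩
  simp only [WQS.c_eq_contract]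
  exact WQS.SComp_eq_sum_contract s t J
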